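/- A von Neumann algebra $\mathcal M$ is said to satisfy the weak similarity property (WSP) if every $w^*$-continuous, unital, bounded homomorphism $u\colon\mathcal M\to\mathcal B(K)$, where $K$ is a Hilbert space, is similar to a $*$-homomorphism, i.e. there is an invertible $S\in\mathcal B(K)$ such that $x\mapsto S^{-1}u(x)S$ is a $*$-homomorphism. Let $\mathcal M$ be a type $II_1$ factor and let $\tau$ be its normal tracial state. Let $n\ge 1$ be an integer and let $P\in\mathcal M$ be a projection such that $\tau(P)=\frac1n$. Then $\mathcal M$ satisfies (WSP) if and only if the corner $P\mathcal M P$, regarded as a von Neumann algebra with unit $P$ (acting on the range of $P$), satisfies (WSP). -/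

import Mathlib

universe u v

noncomputable section

open ContinuousLinearMap

section Ultraweak

variable {H : Type u} [NormedAddCommGroup H] [InnerProductSpace ℂ H] [CompleteSpace H]

/-- The evaluation of a bounded operator `T` at the normal functional attached to two square
summable sequences of vectors, `T ↦ ∑ᵢ ⟪ξᵢ, T ηᵢ⟫`. The series converges absolutely. -/
def normalEval (ξ η : lp (fun _ : ℕ => H) 2) (T : H →L[ℂ] H) : ℂ :=
  ∑' i, inner ℂ (ξ i) (T (η i))

variable (H) in
/-- The w*-topology of `B(H)` (the ultraweak, or σ-weak, topology): the coarsest topology for which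
all functionals `T ↦ ∑ᵢ ⟪ξᵢ, T ηᵢ⟫`, with `∑ᵢ ‖ξᵢ‖² < ∞` and `∑ᵢ ‖ηᵢ‖² < ∞`, are continuous.
These functionals form the predual of `B(H)`. -/
@[reducible] def weakStarTopology : TopologicalSpace (H →L[ℂ] H) :=
  ⨅ (ξ : lp (fun _ : ℕ => H) 2) (η : lp (fun _ : ℕ => H) 2),
    TopologicalSpace.induced (normalEval ξ η) inferInstance

namespace VonNeumannAlgebra

/-- The w*-topology of a von Neumann algebra `M ⊆ B(H)`: the restriction of that of `B(H)`. -/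
@[reducible] def weakStar (M : VonNeumannAlgebra H) : TopologicalSpace M.toStarSubalgebra :=
  TopologicalSpace.induced (fun x => (x : H →L[ℂ] H)) (weakStarTopology H)

/-- The weak similarity property (WSP): every w*-continuous, unital, bounded homomorphism
`M → B(K)`, with `K` a Hilbert space, is similar to a `*`-homomorphism. -/
def WSP (M : VonNeumannAlgebra H) : Prop :=
  ∀ (K : Type v) [NormedAddCommGroup K] [InnerProductSpace ℂ K] [CompleteSpace K]
    (φ : M.toStarSubalgebra →ₐ[ℂ] (K →L[ℂ] K)),
    @Continuous _ _ M.weakStar (weakStarTopology K) φ →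
    (∃ C : ℝ, ∀ x : M.toStarSubalgebra, ‖φ x‖ ≤ C * ‖(x : H →L[ℂ] H)‖) →
    ∃ (S : (K →L[ℂ] K)ˣ) (π : M.toStarSubalgebra →⋆ₐ[ℂ] (K →L[ℂ] K)),
      ∀ x, π x = (↑S⁻¹ : K →L[ℂ] K) * φ x * (S : K →L[ℂ] K)

/-- `M` is a factor of type II₁: it is nonzero, its centre consists of the scalars, it is finite
(every isometry in `M` is a unitary), and it has no nonzero abelian projection. -/
structure IsTypeII₁Factor (M : VonNeumannAlgebra H) : Prop where
  nontrivial : Nontrivial H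
  center_trivial : ∀ x ∈ M, x ∈ M.commutant → ∃ c : ℂ, x = c • (1 : H →L[ℂ] H)
  finite : ∀ w ∈ M, star w * w = 1 → w * star w = 1
  no_abelian_projection : ∀ e ∈ M, IsStarProjection e →
    (∀ x ∈ M, ∀ y ∈ M, (e * x * e) * (e * y * e) = (e * y * e) * (e * x * e)) → e = 0

open scoped ComplexOrder in
/-- `τ` is a normal (that is, w*-continuous) tracial state on `M`. -/
structure IsNormalTracialState (M : VonNeumannAlgebra H) (τ : M.toStarSubalgebra →ₗ[ℂ] ℂ) :
    Prop where
  nonneg : ∀ x, 0 ≤ τ (star x * x)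
  map_one : τ 1 = 1
  tracial : ∀ x y, τ (x * y) = τ (y * x)
  normal : @Continuous _ _ M.weakStar inferInstance τ

end VonNeumannAlgebra

end Ultraweak

section Corner

variable {H : Type u} [NormedAddCommGroup H] [InnerProductSpace ℂ H] [CompleteSpace H]

/-- The space `{ξ | P ξ = ξ}`, which for a projection `P` is its range `PH`. -/
abbrev projSpace (P : H →L[ℂ] H) : Submodule ℂ H :=
  LinearMap.eqLocus (P : H →ₗ[ℂ] H) LinearMap.id

instance (P : H →L[ℂ] H) : CompleteSpace (projSpace P) :=
  (isClosed_eq P.continuous continuous_id).completeSpace_coe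

theorem projSpace_eq_range {P : H →L[ℂ] H} (hP : IsStarProjection P) :
    projSpace P = P.range := by
  ext ξ
  constructor
  · intro h
    exact ⟨ξ, h⟩
  · rintro ⟨η, rfl⟩
    exact congrArg (fun T : H →L[ℂ] H => T η) hP.isIdempotentElem

/-- The extension `ι T ι*` of an operator on `PH` to `H`, zero on the orthogonal complement,
where `ι : PH → H` is the inclusion. -/
def extendByZero (P : H →L[ℂ] H) (T : projSpace P →L[ℂ] projSpace P) : H →L[ℂ] H :=
  (projSpace P).subtypeL ∘L T ∘L adjoint (projSpace P).subtypeL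

theorem adjoint_comp_incl (P : H →L[ℂ] H) :
    adjoint (projSpace P).subtypeL ∘L (projSpace P).subtypeL = 1 := by
  ext1 x
  refine ext_inner_right ℂ fun y => ?_
  rw [comp_apply, adjoint_inner_left]
  rfl

theorem incl_comp_adjoint {P : H →L[ℂ] H} (hP : IsStarProjection P) :
    (projSpace P).subtypeL ∘L adjoint (projSpace P).subtypeL = P := by
  have hsa : adjoint P = P := hP.isSelfAdjoint
  ext x
  have hPx : P x ∈ projSpace P := congrArg (fun T : H →L[ℂ] H => T x) hP.isIdempotentElem
  have h : adjoint (projSpace P).subtypeL x = ⟨P x, hPx⟩ := by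
    refine ext_inner_right ℂ fun y => ?_
    rw [adjoint_inner_left]
    change inner ℂ x (y : H) = inner ℂ (P x) (y : H)
    have hy : P (y : H) = y := y.2
    conv_lhs => rw [← hy, ← adjoint_inner_left, hsa]
  rw [comp_apply, h]
  rfl

theorem extendByZero_one {P : H →L[ℂ] H} (hP : IsStarProjection P) :
    extendByZero P 1 = P :=
  incl_comp_adjoint hP

theorem extendByZero_mul (P : H →L[ℂ] H) (S T : projSpace P →L[ℂ] projSpace P) :
    extendByZero P (S * T) = extendByZero P S * extendByZero P T := by
  ext x
  have h : ∀ z : projSpace P, adjoint (projSpace P).subtypeL ((projSpace P).subtypeL z) = z :=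
    fun z => congrArg (fun R : projSpace P →L[ℂ] projSpace P => R z) (adjoint_comp_incl P)
  change (projSpace P).subtypeL (S (T (adjoint (projSpace P).subtypeL x))) =
    (projSpace P).subtypeL (S (adjoint (projSpace P).subtypeL ((projSpace P).subtypeL
      (T (adjoint (projSpace P).subtypeL x)))))
  rw [h]

theorem extendByZero_add (P : H →L[ℂ] H) (S T : projSpace P →L[ℂ] projSpace P) :
    extendByZero P (S + T) = extendByZero P S + extendByZero P T := by
  ext x
  simp [extendByZero]

theorem extendByZero_smul (P : H →L[ℂ] H) (c : ℂ) (T : projSpace P →L[ℂ] projSpace P) :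
    extendByZero P (c • T) = c • extendByZero P T := by
  ext x
  simp [extendByZero]

theorem extendByZero_star (P : H →L[ℂ] H) (T : projSpace P →L[ℂ] projSpace P) :
    extendByZero P (star T) = star (extendByZero P T) := by
  simp only [extendByZero, star_eq_adjoint, adjoint_comp, adjoint_adjoint]
  rfl

/-- The compression `ι* x ι` of an operator on `H` to `PH`. -/
def compress (P x : H →L[ℂ] H) : projSpace P →L[ℂ] projSpace P :=
  adjoint (projSpace P).subtypeL ∘L x ∘L (projSpace P).subtypeL

theorem extendByZero_compress {P : H →L[ℂ] H} (hP : IsStarProjection P) (x : H →L[ℂ] H) :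
    extendByZero P (compress P x) = P * x * P := by
  conv_rhs => rw [← incl_comp_adjoint hP]
  rfl

theorem compress_extendByZero (P : H →L[ℂ] H) (T : projSpace P →L[ℂ] projSpace P) :
    compress P (extendByZero P T) = T := by
  ext1 x
  have h : ∀ z : projSpace P, adjoint (projSpace P).subtypeL ((projSpace P).subtypeL z) = z :=
    fun z => congrArg (fun R : projSpace P →L[ℂ] projSpace P => R z) (adjoint_comp_incl P)
  simp only [compress, extendByZero, comp_apply, h]

theorem extendByZero_injective (P : H →L[ℂ] H) : Function.Injective (extendByZero P) :=
  Function.LeftInverse.injective (compress_extendByZero P)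

theorem mul_extendByZero {P : H →L[ℂ] H} (hP : IsStarProjection P)
    (T : projSpace P →L[ℂ] projSpace P) : P * extendByZero P T = extendByZero P T := by
  have h := extendByZero_mul P 1 T
  rwa [one_mul, extendByZero_one hP, eq_comm] at h

theorem extendByZero_mul_self {P : H →L[ℂ] H} (hP : IsStarProjection P)
    (T : projSpace P →L[ℂ] projSpace P) : extendByZero P T * P = extendByZero P T := by
  have h := extendByZero_mul P T 1
  rwa [mul_one, extendByZero_one hP, eq_comm] at h

namespace VonNeumannAlgebra

/-- The corner `PMP` of a von Neumann algebra `M` at a projection `P ∈ M`, as a von Neumann algebra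
acting on `PH`: it consists of the operators on `PH` whose extension by zero belongs to `M`, that
is, of the restrictions to `PH` of the operators `P x P` with `x ∈ M` (see `mem_corner_iff`). -/
def corner (M : VonNeumannAlgebra H) (P : M.toStarSubalgebra) (hP : IsStarProjection P) :
    VonNeumannAlgebra (projSpace (P : H →L[ℂ] H)) where
  carrier := {T | extendByZero (P : H →L[ℂ] H) T ∈ M}
  mul_mem' {S T} hS hT := by
    change extendByZero _ _ ∈ M
    rw [extendByZero_mul]
    exact mul_mem hS hT
  add_mem' {S T} hS hT := by
    change extendByZero _ _ ∈ M
    rw [extendByZero_add]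
    exact add_mem hS hT
  algebraMap_mem' c := by
    change extendByZero _ _ ∈ M
    rw [Algebra.algebraMap_eq_smul_one, extendByZero_smul,
      extendByZero_one (show IsStarProjection (P : H →L[ℂ] H) from
        hP.map M.toStarSubalgebra.subtype)]
    exact M.toStarSubalgebra.smul_mem P.2 c
  star_mem' {T} hT := by
    change extendByZero _ _ ∈ M
    rw [extendByZero_star]
    exact star_mem hT
  centralizer_centralizer' := by
    have hQ : IsStarProjection (P : H →L[ℂ] H) := hP.map M.toStarSubalgebra.subtype
    have hPM : (P : H →L[ℂ] H) ∈ M := P.2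
    refine Set.Subset.antisymm (fun T hT => ?_) Set.subset_centralizer_centralizer
    change extendByZero _ T ∈ M
    suffices h : extendByZero (P : H →L[ℂ] H) T ∈ M.commutant.commutant from
      (SetLike.ext_iff.1 (commutant_commutant M) _).1 h
    rw [mem_commutant_iff]
    intro y hy
    rw [mem_commutant_iff] at hy
    have hyP := hy _ hPM
    -- the compression of `y` commutes with the corner
    have hc : compress (P : H →L[ℂ] H) y ∈ Set.centralizer
        {T | extendByZero (P : H →L[ℂ] H) T ∈ M} := by
      intro S hS
      apply extendByZero_injective
      rw [extendByZero_mul, extendByZero_mul, extendByZero_compress hQ]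
      have h1 : (P : H →L[ℂ] H) * y * P = y * P := by
        rw [hyP, mul_assoc, hQ.isIdempotentElem.eq]
      rw [h1, mul_assoc, mul_extendByZero hQ, ← hyP, ← mul_assoc, extendByZero_mul_self hQ]
      exact hy _ hS
    have h := congrArg (extendByZero (P : H →L[ℂ] H)) (hT _ hc)
    rw [extendByZero_mul, extendByZero_mul, extendByZero_compress hQ] at h
    have h1 : (P : H →L[ℂ] H) * y * P = y * P := by
      rw [hyP, mul_assoc, hQ.isIdempotentElem.eq]
    rwa [h1, mul_assoc, mul_extendByZero hQ, ← hyP, ← mul_assoc, extendByZero_mul_self hQ] at h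

theorem mem_corner_iff (M : VonNeumannAlgebra H) (P : M.toStarSubalgebra)
    (hP : IsStarProjection P) (T : projSpace (P : H →L[ℂ] H) →L[ℂ] projSpace (P : H →L[ℂ] H)) :
    T ∈ M.corner P hP ↔ ∃ x ∈ M, extendByZero (P : H →L[ℂ] H) T = P * x * P := by
  have hQ : IsStarProjection (P : H →L[ℂ] H) := hP.map M.toStarSubalgebra.subtype
  constructor
  · intro h
    exact ⟨_, h, by rw [mul_extendByZero hQ, extendByZero_mul_self hQ]⟩
  · rintro ⟨x, hx, h⟩
    change extendByZero _ _ ∈ M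
    rw [h]
    exact mul_mem (mul_mem P.2 hx) P.2

end VonNeumannAlgebra

end Corner

end

/-! The trace condition makes `M` the algebra of `n × n` matrices over the corner: there are `V i`
in `M` with `V i* V j = δᵢⱼ P` and `∑ V i V i* = 1` (`exists_matrixUnits`). WSP then passes both
ways along these matrix units.

To find them, partial isometries are produced as extreme points of weak-operator compact unit balls
(`exists_maximal_partialIsometry`). Applied to `qMp`, and since nonzero elements of a factor are
never separated by `e M f = 0`, this gives comparison of projections; applied to the null ideal of
`τ`, it gives faithfulness. Hence copies of `P` can be split off one at a time until trace `1` is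
used up, and what remains has trace `0`, so vanishes.

For WSP, similarity of `φ` to a `*`-homomorphism is restated as the existence of a positive
invertible `A` with `φ(x*) A = A φ(x)*` (`similar_starAlgHom_iff`). Such an `A` is easy to move.
From `M` to the corner: amplify `φ` to the matrix `(φ(V i* x V j))` on `Kⁿ` and compress the
resulting operator to one coordinate. From the corner to `M`: restrict `φ` to the range of the
idempotent `φ(P)`, obtain an intertwiner `a` there, and spread it out as `∑ φ(V i) a φ(V i)*`. -/

noncomputable section

open ContinuousLinearMap

/-! ### Weak operator limits of bounded filters -/

section WeakOperatorLimits

open Filter Topology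

variable {H : Type u} [NormedAddCommGroup H] [InnerProductSpace ℂ H] [CompleteSpace H]

/-- Convergence of a filter of operators to `T` in the weak operator topology. -/
def WeakOperatorTendsto (U : Filter (H →L[ℂ] H)) (T : H →L[ℂ] H) : Prop :=
  ∀ x y : H, Tendsto (fun S : H →L[ℂ] H => inner ℂ x (S y)) U (𝓝 (inner ℂ x (T y)))

theorem WeakOperatorTendsto.map_mul_mul {U : Filter (H →L[ℂ] H)} {T : H →L[ℂ] H}
    (h : WeakOperatorTendsto U T) (a b : H →L[ℂ] H) :
    WeakOperatorTendsto (U.map fun S => a * S * b) (a * T * b) := by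
  intro x y
  rw [tendsto_map'_iff]
  have := h (adjoint a x) (b y)
  simp only [adjoint_inner_left] at this
  exact this

omit [CompleteSpace H] in
theorem WeakOperatorTendsto.unique {U : Filter (H →L[ℂ] H)} [U.NeBot] {T T' : H →L[ℂ] H}
    (h : WeakOperatorTendsto U T) (h' : WeakOperatorTendsto U T') : T = T' := by
  ext y
  exact ext_inner_left ℂ fun x => tendsto_nhds_unique (h x y) (h' x y)

/-- Multiplication by a fixed operator is weak-operator continuous, so commuting with each element
of the commutant survives the limit; the bicommutant theorem concludes. -/
theorem WeakOperatorTendsto.mem {U : Filter (H →L[ℂ] H)} [U.NeBot] {T : H →L[ℂ] H}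
    (h : WeakOperatorTendsto U T) (M : VonNeumannAlgebra H) (hU : ∀ᶠ S in U, S ∈ M) : T ∈ M := by
  rw [← M.commutant_commutant, VonNeumannAlgebra.mem_commutant_iff]
  intro y hy
  have h1 := h.map_mul_mul y 1
  have h2 := h.map_mul_mul 1 y
  have h3 : (U.map fun S => y * S * 1) = U.map fun S => 1 * S * y := by
    refine Filter.map_congr (hU.mono fun S hS => ?_)
    simpa using ((VonNeumannAlgebra.mem_commutant_iff.1 hy) S hS).symm
  rw [h3] at h1
  simpa using h1.unique h2

/-- Bounded ultrafilters of operators converge in the weak operator topology. -/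
theorem exists_weakOperatorTendsto (U : Ultrafilter (H →L[ℂ] H))
    (hU : ∀ᶠ S in (U : Filter (H →L[ℂ] H)), ‖S‖ ≤ 1) :
    ∃ T : H →L[ℂ] H, ‖T‖ ≤ 1 ∧ WeakOperatorTendsto (U : Filter (H →L[ℂ] H)) T := by
  have hb : ∀ x y : H, ∀ᶠ S in (U : Filter (H →L[ℂ] H)), ‖(inner ℂ (S x) y : ℂ)‖ ≤ ‖x‖ * ‖y‖ := by
    intro x y
    filter_upwards [hU] with S hS
    refine (norm_inner_le_norm _ _).trans ?_
    gcongr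
    simpa using S.le_of_opNorm_le hS x
  have hlim : ∀ x y : H, ∃ z : ℂ, ‖z‖ ≤ ‖x‖ * ‖y‖ ∧
      Tendsto (fun S : H →L[ℂ] H => inner ℂ (S x) y) U (𝓝 z) := by
    intro x y
    obtain ⟨z, hz, hz'⟩ := (isCompact_closedBall (0 : ℂ) (‖x‖ * ‖y‖)).ultrafilter_le_nhds
      (U.map fun S : H →L[ℂ] H => (inner ℂ (S x) y : ℂ)) (by
        rw [le_principal_iff]
        refine (hb x y).mono fun S hS => ?_
        simpa using hS)
    exact ⟨z, by simpa using hz, hz'⟩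
  choose g hg hg' using hlim
  -- The pointwise limits form a sesquilinear form of norm at most `1`, which the Riesz
  -- representation turns into an operator.
  let B : H →L⋆[ℂ] H →L[ℂ] ℂ := LinearMap.mkContinuous₂
    (LinearMap.mk₂'ₛₗ (starRingEnd ℂ) (RingHom.id ℂ) g
      (fun x x' y => tendsto_nhds_unique (hg' _ _)
        (by simpa [inner_add_left] using (hg' x y).add (hg' x' y)))
      (fun c x y => tendsto_nhds_unique (hg' _ _)
        (by simpa [inner_smul_left, mul_comm] using (hg' x y).const_mul (starRingEnd ℂ c)))
      (fun x y y' => tendsto_nhds_unique (hg' _ _)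
        (by simpa [inner_add_right] using (hg' x y).add (hg' x y')))
      (fun c x y => tendsto_nhds_unique (hg' _ _)
        (by simpa [inner_smul_right] using (hg' x y).const_mul c)))
    1 (fun x y => by simpa using hg x y)
  have hB : ∀ x y, inner ℂ (InnerProductSpace.continuousLinearMapOfBilin B x) y = g x y :=
    fun x y => InnerProductSpace.continuousLinearMapOfBilin_apply B x y
  refine ⟨InnerProductSpace.continuousLinearMapOfBilin B, ?_, fun x y => ?_⟩
  · refine opNorm_le_bound _ zero_le_one fun x => ?_
    set z := InnerProductSpace.continuousLinearMapOfBilin B x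
    have h1 : ‖z‖ * ‖z‖ ≤ ‖x‖ * ‖z‖ := by
      rw [← inner_self_eq_norm_mul_norm (𝕜 := ℂ) z, hB]
      exact (RCLike.re_le_norm _).trans (hg _ _)
    rw [one_mul]
    rcases (norm_nonneg z).eq_or_lt with h0 | h0
    · rw [← h0]; exact norm_nonneg x
    · exact le_of_mul_le_mul_right h1 h0
  · have := (Complex.continuous_conj.tendsto _).comp (hg' y x)
    rw [← hB] at this
    rw [inner_conj_symm] at this
    refine this.congr fun S => ?_
    exact inner_conj_symm _ _

omit [CompleteSpace H] in
-- On bounded sets the series defining a normal functional is dominated by `r ‖ξᵢ‖ ‖ηᵢ‖`, so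
-- termwise convergence suffices.
theorem tendsto_weakStar_of_weakOperatorTendsto {U : Filter (H →L[ℂ] H)} {T : H →L[ℂ] H}
    (h : WeakOperatorTendsto U T) {r : ℝ} (hr : ∀ᶠ S in U, ‖S‖ ≤ r) :
    U ≤ @nhds _ (weakStarTopology H) T := by
  rw [nhds_iInf]
  refine le_iInf fun ξ => ?_
  rw [nhds_iInf]
  refine le_iInf fun η => ?_
  rw [nhds_induced, ← tendsto_iff_comap]
  have hs : Summable fun i => ‖ξ i‖ * (r * ‖η i‖) := by
    have := (lp.summable_mul (p := 2) (q := 2)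
      (by simpa using Real.HolderConjugate.two_two) ξ η).mul_left r
    refine this.congr fun i => ?_
    ring
  refine tendsto_tsum_of_dominated_convergence hs (fun i => h _ _) ?_
  filter_upwards [hr] with S hS i
  exact (norm_inner_le_norm _ _).trans
    (mul_le_mul_of_nonneg_left (S.le_of_opNorm_le hS _) (norm_nonneg _))

/-- Kernels of normal functionals are closed under bounded weak operator limits. -/
theorem eq_zero_of_weakOperatorTendsto (M : VonNeumannAlgebra H) (τ : M.toStarSubalgebra → ℂ)
    (hτ : @Continuous _ _ M.weakStar inferInstance τ) {U : Filter (H →L[ℂ] H)} [U.NeBot]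
    {T : H →L[ℂ] H} (h : WeakOperatorTendsto U T) {r : ℝ} (hr : ∀ᶠ S in U, ‖S‖ ≤ r)
    (h0 : ∀ᶠ S in U, ∃ hS : S ∈ M.toStarSubalgebra, τ ⟨S, hS⟩ = 0)
    (hT : T ∈ M.toStarSubalgebra) :
    τ ⟨T, hT⟩ = 0 := by
  have hle := tendsto_weakStar_of_weakOperatorTendsto h hr
  have h1 : Tendsto τ (comap Subtype.val U) (𝓝 (τ ⟨T, hT⟩)) := by
    refine (@Continuous.tendsto _ _ M.weakStar _ _ hτ ⟨T, hT⟩).mono_left ?_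
    rw [@nhds_induced]
    exact comap_mono hle
  have hne : (comap (Subtype.val : M.toStarSubalgebra → _) U).NeBot := by
    rw [comap_neBot_iff_frequently]
    exact (h0.mono fun S hS => ⟨⟨S, hS.1⟩, rfl⟩).frequently
  refine tendsto_nhds_unique h1 (tendsto_const_nhds.congr' ?_)
  have := h0.comap (Subtype.val : M.toStarSubalgebra → _)
  filter_upwards [this] with S hS
  exact hS.2.symm

end WeakOperatorLimits

/-! ### Extreme points, partial isometries and comparison in a factor -/

section Comparison

open Filter Topology

variable {H : Type u} [NormedAddCommGroup H] [InnerProductSpace ℂ H] [CompleteSpace H]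

/-- The Krein–Milman theorem for a weak-operator closed unit ball. -/
theorem exists_extreme_contraction (X : Submodule ℂ (H →L[ℂ] H))
    (hX : ∀ (U : Ultrafilter (H →L[ℂ] H)) (T : H →L[ℂ] H),
      (∀ᶠ S in (U : Filter (H →L[ℂ] H)), S ∈ X) →
      (∀ᶠ S in (U : Filter (H →L[ℂ] H)), ‖S‖ ≤ 1) →
      WeakOperatorTendsto (U : Filter (H →L[ℂ] H)) T → T ∈ X) :
    ∃ w ∈ X, ‖w‖ ≤ 1 ∧ ∀ y ∈ X, ‖w + y‖ ≤ 1 → ‖w - y‖ ≤ 1 → y = 0 := by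
  -- Matrix coefficients embed the operators in a product of copies of `ℂ`, whose topology induces
  -- the weak operator one; Krein–Milman is applied in that product.
  let j : (H →L[ℂ] H) → H → H → ℂ := fun T x y => inner ℂ x (T y)
  have hj : Function.Injective j := fun S T h => by
    ext y
    exact ext_inner_left ℂ fun x => congrFun (congrFun h x) y
  let A : Set (H →L[ℂ] H) := {T | T ∈ X ∧ ‖T‖ ≤ 1}
  have hA : IsCompact (j '' A) := by
    rw [isCompact_iff_ultrafilter_le_nhds]
    intro V hV
    have hVA : j '' A ∈ (V : Filter (H → H → ℂ)) := le_principal_iff.1 hV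
    have hr : Set.range j ∈ V := mem_of_superset hVA (Set.image_subset_range _ _)
    let U : Ultrafilter (H →L[ℂ] H) := V.comap hj hr
    have hUA : ∀ᶠ S in (U : Filter (H →L[ℂ] H)), S ∈ A := by
      rw [Ultrafilter.coe_comap, eventually_comap]
      filter_upwards [hVA] with f hf S hS
      obtain ⟨T, hT, rfl⟩ := hf
      rwa [hj hS]
    obtain ⟨T, hT1, hT⟩ := exists_weakOperatorTendsto U (hUA.mono fun S hS => hS.2)
    refine ⟨j T, ⟨T, ⟨hX U T (hUA.mono fun S hS => hS.1) (hUA.mono fun S hS => hS.2) hT, hT1⟩,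
      rfl⟩, ?_⟩
    have hVU : (V : Filter (H → H → ℂ)) = (U : Filter (H →L[ℂ] H)).map j := by
      rw [Ultrafilter.coe_comap, map_comap_of_mem hr]
    rw [hVU]
    change Tendsto j _ _
    rw [tendsto_pi_nhds]
    intro x
    rw [tendsto_pi_nhds]
    exact hT x
  obtain ⟨f, hf⟩ := hA.extremePoints_nonempty ⟨j 0, 0, ⟨X.zero_mem, by simp⟩, rfl⟩
  rw [mem_extremePoints_iff_left] at hf
  obtain ⟨⟨w, ⟨hwX, hw1⟩, rfl⟩, hw⟩ := hf
  refine ⟨w, hwX, hw1, fun y hy h1 h2 => ?_⟩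
  have h := hw (j (w + y)) ⟨_, ⟨X.add_mem hwX hy, h1⟩, rfl⟩ (j (w - y))
    ⟨_, ⟨X.sub_mem hwX hy, h2⟩, rfl⟩
    ⟨1 / 2, 1 / 2, by norm_num, by norm_num, by norm_num, by
      funext a b
      simp only [j, Pi.add_apply, Pi.smul_apply, add_apply, sub_apply, inner_add_right,
        inner_sub_right, Complex.real_smul]
      push_cast
      ring⟩
  simpa using hj h

theorem norm_le_one_iff_star_mul_self_le_one (x : H →L[ℂ] H) :
    ‖x‖ ≤ 1 ↔ star x * x ≤ 1 := by
  rw [← CStarAlgebra.norm_le_one_iff_of_nonneg (star x * x) (star_mul_self_nonneg x),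
    CStarRing.norm_star_mul_self]
  constructor <;> intro h <;> nlinarith [norm_nonneg x]

/-- A subspace of `B(H)` closed under `x y* z` whose unit ball is weak-operator closed contains a
partial isometry that is maximal. -/
theorem exists_maximal_partialIsometry (X : Submodule ℂ (H →L[ℂ] H))
    (hX : ∀ (U : Ultrafilter (H →L[ℂ] H)) (T : H →L[ℂ] H),
      (∀ᶠ S in (U : Filter (H →L[ℂ] H)), S ∈ X) →
      (∀ᶠ S in (U : Filter (H →L[ℂ] H)), ‖S‖ ≤ 1) →
      WeakOperatorTendsto (U : Filter (H →L[ℂ] H)) T → T ∈ X)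
    (hmul : ∀ x ∈ X, ∀ y ∈ X, ∀ z ∈ X, x * star y * z ∈ X) :
    ∃ w ∈ X, w * star w * w = w ∧
      ∀ x ∈ X, (1 - w * star w) * x * (1 - star w * w) = 0 := by
  obtain ⟨w, hw, hw1, hext⟩ := exists_extreme_contraction X hX
  have hc1 := (norm_le_one_iff_star_mul_self_le_one w).1 hw1
  have hiso : w * star w * w = w := by
    -- Extremality is tested on `y = ½(w - w w* w)`. With `c = w* w`, `w + y = ½ w(3 - c)` and `1 -
    -- (w + y)*(w + y) = ¼((1 - c)³ + 3(1 - c)²) ≥ 0`, while `w - y` is an average of two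
    -- contractions.
    have hz : (1 / 2 : ℂ) • (w - w * star w * w) ∈ X :=
      X.smul_mem _ (X.sub_mem hw (hmul w hw w hw w hw))
    have h := hext _ hz ?_ ?_
    · rw [smul_eq_zero_iff_right (by norm_num), sub_eq_zero] at h
      exact h.symm
    · rw [norm_le_one_iff_star_mul_self_le_one]
      set c := star w * w with hc
      have hcs : IsSelfAdjoint c := IsSelfAdjoint.star_mul_self w
      have h4 : 0 ≤ (1 - c) * (1 - c) * (1 - c) + (3 : ℝ) • (star (1 - c) * (1 - c)) := by
        have e1 : (1 - c) * (1 - c) * (1 - c) = star (1 - c) * (1 - c) * (1 - c) := by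
          simp [hcs.star_eq]
        rw [e1]
        have := star_left_conjugate_nonneg (sub_nonneg.2 hc1) (1 - c)
        refine add_nonneg this (smul_nonneg (by norm_num) (star_mul_self_nonneg _))
      have h5 : 1 - star (w + (1 / 2 : ℂ) • (w - w * star w * w)) *
          (w + (1 / 2 : ℂ) • (w - w * star w * w)) =
          (1 / 4 : ℝ) • ((1 - c) * (1 - c) * (1 - c) + (3 : ℝ) • (star (1 - c) * (1 - c))) := by
        have e : w + (1 / 2 : ℂ) • (w - w * star w * w) = (1 / 2 : ℂ) • (w * (3 - c)) := by
          rw [hc]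
          have : w = (1 / 2 : ℂ) • (2 : ℂ) • w := by rw [smul_smul]; norm_num
          conv_lhs => enter [1]; rw [this]
          rw [← smul_add]
          congr 1
          rw [two_smul]
          noncomm_ring
        rw [e]
        have e' : star ((1 / 2 : ℂ) • (w * (3 - c))) * ((1 / 2 : ℂ) • (w * (3 - c)))
            = (1 / 4 : ℝ) • ((3 - c) * c * (3 - c)) := by
          have h3 : star (3 : H →L[ℂ] H) = 3 := by simp
          rw [star_smul, star_mul, star_sub, h3, hcs.star_eq, smul_mul_smul_comm]
          rw [show (star (1 / 2 : ℂ) * (1 / 2)) = ((1 / 4 : ℝ) : ℂ) by simp; norm_num]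
          rw [hc]
          simp only [mul_assoc]
          rfl
        rw [e', star_sub, star_one, hcs.star_eq]
        have : (1 : H →L[ℂ] H) = (1 / 4 : ℝ) • (4 : H →L[ℂ] H) := by
          rw [show (4 : H →L[ℂ] H) = (4 : ℝ) • 1 by
            rw [Algebra.smul_def, map_ofNat, mul_one], smul_smul]; norm_num
        conv_lhs => enter [1]; rw [this]
        rw [← smul_sub]
        congr 1
        rw [show (3 : ℝ) • ((1 - c) * (1 - c)) = (3 : H →L[ℂ] H) * ((1 - c) * (1 - c)) by
          rw [Algebra.smul_def, map_ofNat]]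
        rw [show (4 : H →L[ℂ] H) = 1 + 1 + 1 + 1 by norm_num]
        noncomm_ring
      rw [← sub_nonneg, h5]
      exact smul_nonneg (by norm_num) h4
    · have e : w - (1 / 2 : ℂ) • (w - w * star w * w) =
          (1 / 2 : ℂ) • w + (1 / 2 : ℂ) • (w * star w * w) := by
        rw [smul_sub]
        have : w = (1 / 2 : ℂ) • w + (1 / 2 : ℂ) • w := by rw [← add_smul]; norm_num
        conv_lhs => enter [1]; rw [this]
        abel
      rw [e]
      have h3 : ‖w * star w * w‖ ≤ 1 := by
        refine (norm_mul_le _ _).trans ?_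
        refine mul_le_one₀ ?_ (norm_nonneg _) hw1
        refine (norm_mul_le _ _).trans ?_
        exact mul_le_one₀ hw1 (norm_nonneg _) (by rwa [norm_star])
      refine (norm_add_le _ _).trans ?_
      rw [norm_smul, norm_smul]
      norm_num
      linarith
  refine ⟨w, hw, hiso, fun x hx => ?_⟩
  set f := 1 - star w * w with hf
  set y := (1 - w * star w) * x * f with hy
  have hiso' : star w * w * star w = star w := by
    simpa [mul_assoc] using congrArg star hiso
  have hfs : star f = f := by simp [hf]
  have hff : f * f = f := by
    have : star w * w * (star w * w) = star w * w := by rw [← mul_assoc, hiso']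
    simp only [hf, sub_mul, mul_sub, this]
    simp
  have hyX : y ∈ X := by
    have : y = x - w * star w * x - x * star w * w + w * star w * (x * star w * w) := by
      rw [hy, hf]; noncomm_ring
    rw [this]
    have h1 := hmul x hx w hw w hw
    exact X.add_mem (X.sub_mem (X.sub_mem hx (hmul w hw w hw x hx)) h1) (hmul w hw w hw _ h1)
  have hwy : star w * y = 0 := by
    rw [hy]
    have : star w * (1 - w * star w) = 0 := by
      rw [mul_sub, ← mul_assoc, hiso']; simp
    rw [← mul_assoc, ← mul_assoc, this, zero_mul, zero_mul]
  have hyw : star y * w = 0 := by simpa using congrArg star hwy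
  have hyf : y * f = y := by rw [hy, mul_assoc, hff]
  -- Such a `z` lives on the complement of the initial space of `w` and has range orthogonal to that
  -- of `w`, so adding it does not increase the norm beyond `1`. The same holds for `-z`, and
  -- extremality kills `z`.
  have key : ∀ z : H →L[ℂ] H, ‖z‖ ≤ 1 → z * f = z → star w * z = 0 → star z * w = 0 →
      ‖w + z‖ ≤ 1 := by
    intro z hz hzf h1 h2
    rw [norm_le_one_iff_star_mul_self_le_one] at hz ⊢
    have e : star (w + z) * (w + z) = star w * w + star z * z := by
      rw [star_add, add_mul, mul_add, mul_add, h1, h2]; simp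
    have h3 : star z * z ≤ f := by
      have := star_left_conjugate_le_conjugate hz f
      rwa [mul_one, hfs, hff, ← mul_assoc, mul_assoc, hzf, ← hfs, ← star_mul, hzf, hfs] at this
    rw [e]
    calc star w * w + star z * z ≤ star w * w + f := by gcongr
      _ = 1 := by rw [hf]; abel
  by_contra h0
  have hn : (‖y‖ : ℂ) ≠ 0 := by simpa using h0
  set z := (‖y‖ : ℂ)⁻¹ • y with hz
  have hz1 : ‖z‖ ≤ 1 := by
    rw [hz, norm_smul, norm_inv, Complex.norm_real, norm_norm, inv_mul_cancel₀ (by simpa using h0)]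
  have hzf : z * f = z := by rw [hz, smul_mul_assoc, hyf]
  have hwz : star w * z = 0 := by rw [hz, mul_smul_comm, hwy, smul_zero]
  have hzw : star z * w = 0 := by simpa using congrArg star hwz
  have hz0 := hext z (X.smul_mem _ hyX) (key z hz1 hzf hwz hzw) (by
    rw [sub_eq_add_neg]
    exact key (-z) (by rwa [norm_neg]) (by rw [neg_mul, hzf]) (by rw [mul_neg, hwz, neg_zero])
      (by rw [star_neg, neg_mul, hzw, neg_zero]))
  rw [hz, smul_eq_zero] at hz0
  exact hz0.elim (inv_ne_zero hn) h0

namespace VonNeumannAlgebra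

variable {M : VonNeumannAlgebra H}

/-- The projection `z` onto the closed span of `M f H` is central, because that space is invariant
under both `M` and its commutant. So `z = c • 1`; since `z f = f` and `e z = 0`, `c = 0` gives `f =
0` and `c ≠ 0` gives `e = 0`. -/
theorem eq_zero_or_eq_zero_of_mul_mul_eq_zero
    (hM : ∀ x ∈ M, x ∈ M.commutant → ∃ c : ℂ, x = c • (1 : H →L[ℂ] H))
    {e f : H →L[ℂ] H} (hf : f ∈ M) (h : ∀ x ∈ M, e * x * f = 0) : e = 0 ∨ f = 0 := by
  let Z₀ : Submodule ℂ H := Submodule.span ℂ {v | ∃ x ∈ M, ∃ ξ : H, v = x (f ξ)}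
  let Z : Submodule ℂ H := Z₀.topologicalClosure
  have hinv : ∀ y : H →L[ℂ] H, (∀ x ∈ M, ∀ ξ, ∃ x' ∈ M, ∃ ξ', y (x (f ξ)) = x' (f ξ')) →
      Z ∈ Module.End.invtSubmodule (y : H →ₗ[ℂ] H) := by
    intro y hy
    have h0 : Z₀ ≤ Z₀.comap (y : H →ₗ[ℂ] H) := by
      refine Submodule.span_le.2 ?_
      rintro _ ⟨x, hx, ξ, rfl⟩
      obtain ⟨x', hx', ξ', h'⟩ := hy x hx ξ
      exact Submodule.subset_span ⟨x', hx', ξ', h'⟩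
    change Z ≤ Z.comap (y : H →ₗ[ℂ] H)
    refine Submodule.topologicalClosure_minimal _
      (h0.trans (Submodule.comap_mono Z₀.le_topologicalClosure)) ?_
    exact Z₀.isClosed_topologicalClosure.preimage y.continuous
  have : CompleteSpace Z := Z₀.isClosed_topologicalClosure.completeSpace_coe
  let z := Z.starProjection
  have hz : IsStarProjection z := isStarProjection_starProjection
  have hzr : z.range = Z := Submodule.range_starProjection Z
  have hzM : z ∈ M := by
    rw [IsStarProjection.mem_iff hz]
    intro y hy
    rw [hzr]
    refine hinv y fun x hx ξ => ⟨x, hx, y ξ, ?_⟩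
    have h1 := mem_commutant_iff.1 hy x hx
    have h2 := mem_commutant_iff.1 hy f hf
    calc y (x (f ξ)) = (y * x) (f ξ) := rfl
      _ = x ((y * f) ξ) := by rw [← h1]; rfl
      _ = x (f (y ξ)) := by rw [← h2]; rfl
  have hzM' : z ∈ M.commutant := by
    rw [IsStarProjection.mem_iff hz, commutant_commutant]
    intro y hy
    rw [hzr]
    exact hinv y fun x hx ξ => ⟨y * x, mul_mem hy hx, ξ, rfl⟩
  have hzf : z * f = f := by
    ext ξ
    refine Submodule.starProjection_eq_self_iff.2 (Z₀.le_topologicalClosure ?_)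
    exact Submodule.subset_span ⟨1, one_mem M, ξ, rfl⟩
  have hez : e * z = 0 := by
    have h0 : Z ≤ LinearMap.ker (e : H →ₗ[ℂ] H) := by
      refine Submodule.topologicalClosure_minimal _ (Submodule.span_le.2 ?_) e.isClosed_ker
      rintro _ ⟨x, hx, ξ, rfl⟩
      exact congrArg (fun T : H →L[ℂ] H => T ξ) (h x hx)
    ext ξ
    exact h0 (Submodule.starProjection_apply_mem Z ξ)
  obtain ⟨c, hc⟩ := hM z hzM hzM'
  by_cases hc0 : c = 0
  · right
    rw [← hzf, hc, hc0, zero_smul, zero_mul]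
  · left
    rw [hc, mul_smul_comm, mul_one, smul_eq_zero] at hez
    exact hez.resolve_left hc0

/-- The comparison theorem for projections of a factor. -/
theorem exists_partialIsometry_of_factor
    (hM : ∀ x ∈ M, x ∈ M.commutant → ∃ c : ℂ, x = c • (1 : H →L[ℂ] H))
    {p q : H →L[ℂ] H} (hpM : p ∈ M) (hqM : q ∈ M)
    (hp : IsStarProjection p) (hq : IsStarProjection q) :
    ∃ w ∈ M, q * w = w ∧ w * p = w ∧ (star w * w = p ∨ w * star w = q) := by
  have hpp := hp.isIdempotentElem.eq
  have hqq := hq.isIdempotentElem.eq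
  let X : Submodule ℂ (H →L[ℂ] H) :=
    { carrier := {x | x ∈ M ∧ q * x * p = x}
      add_mem' := fun {a b} ha hb => ⟨add_mem ha.1 hb.1, by rw [mul_add, add_mul, ha.2, hb.2]⟩
      zero_mem' := ⟨zero_mem M, by simp⟩
      smul_mem' := fun c x hx => ⟨M.toStarSubalgebra.smul_mem hx.1 c, by
        rw [mul_smul_comm, smul_mul_assoc, hx.2]⟩ }
  have hXl : ∀ {x}, x ∈ X → q * x = x := fun {x} hx => by
    rw [← hx.2, ← mul_assoc, ← mul_assoc, hqq]
  have hXr : ∀ {x}, x ∈ X → x * p = x := fun {x} hx => by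
    rw [← hx.2, mul_assoc, hpp]
  have hX : ∀ (U : Ultrafilter (H →L[ℂ] H)) (T : H →L[ℂ] H),
      (∀ᶠ S in (U : Filter (H →L[ℂ] H)), S ∈ X) →
      (∀ᶠ S in (U : Filter (H →L[ℂ] H)), ‖S‖ ≤ 1) →
      WeakOperatorTendsto (U : Filter (H →L[ℂ] H)) T → T ∈ X := by
    intro U T hU _ hT
    refine ⟨hT.mem M (hU.mono fun S hS => hS.1), ?_⟩
    have h1 := hT.map_mul_mul q p
    have h2 : (U : Filter (H →L[ℂ] H)).map (fun S => q * S * p) = U := by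
      conv_rhs => rw [← Filter.map_id (f := (U : Filter (H →L[ℂ] H)))]
      exact Filter.map_congr (hU.mono fun S hS => hS.2)
    rw [h2] at h1
    exact h1.unique hT
  have hmul : ∀ x ∈ X, ∀ y ∈ X, ∀ z ∈ X, x * star y * z ∈ X := by
    intro x hx y hy z hz
    refine ⟨mul_mem (mul_mem hx.1 (star_mem hy.1)) hz.1, ?_⟩
    rw [mul_assoc, mul_assoc (x * star y), hXr hz, ← mul_assoc, ← mul_assoc, hXl hx]
  obtain ⟨w, hw, hiso, hmax⟩ := exists_maximal_partialIsometry X hX hmul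
  refine ⟨w, hw.1, hXl hw, hXr hw, ?_⟩
  -- Maximality of `w` says that the defects `q - w w*` and `p - w* w` are separated by `M`, so one
  -- of them vanishes.
  have h := eq_zero_or_eq_zero_of_mul_mul_eq_zero hM (e := q - w * star w)
    (f := p - star w * w) (sub_mem hpM (mul_mem (star_mem hw.1) hw.1)) ?_
  · rw [sub_eq_zero, sub_eq_zero] at h
    exact h.symm.imp Eq.symm Eq.symm
  · intro x hx
    have hx' : q * x * p ∈ X := ⟨mul_mem (mul_mem hqM hx) hpM, by
      rw [← mul_assoc, ← mul_assoc, hqq, mul_assoc, hpp]⟩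
    have h1 := hmax _ hx'
    have hl : star w * q = star w := by
      simpa [hq.isSelfAdjoint.star_eq] using congrArg star (hXl hw)
    have hr : p * star w = star w := by
      simpa [hp.isSelfAdjoint.star_eq] using congrArg star (hXr hw)
    have e1 : (1 - w * star w) * q = q - w * star w := by
      rw [sub_mul, one_mul, mul_assoc, hl]
    have e2 : p * (1 - star w * w) = p - star w * w := by
      rw [mul_sub, mul_one, ← mul_assoc, hr]
    rw [← e1, ← e2, ← h1]
    simp only [mul_assoc]

end VonNeumannAlgebra

end Comparison

/-! ### Faithfulness of the trace and matrix units -/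

namespace VonNeumannAlgebra

open Filter Topology

variable {H : Type u} [NormedAddCommGroup H] [InnerProductSpace ℂ H] [CompleteSpace H]
  {M : VonNeumannAlgebra H} {τ : M.toStarSubalgebra →ₗ[ℂ] ℂ}

-- The Cauchy–Schwarz argument: positivity of `τ` on `(e + l w)* (e + l w)` for all scalars `l`.
open scoped ComplexOrder in
theorem IsNormalTracialState.map_mul_eq_zero (hτ : M.IsNormalTracialState τ)
    {e : M.toStarSubalgebra} (he : τ (star e * e) = 0) (w : M.toStarSubalgebra) :
    τ (star e * w) = 0 := by
  set a := τ (star e * w) with ha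
  set b := τ (star w * e) with hb
  set c := τ (star w * w) with hc
  have key : ∀ l : ℂ, 0 ≤ l * a + star l * b + star l * l * c := by
    intro l
    have h := hτ.nonneg (e + l • w)
    have h' : star (e + l • w) * (e + l • w) = star e * e + l • (star e * w) +
        star l • (star w * e) + (star l * l) • (star w * w) := by
      rw [star_add, star_smul, add_mul, mul_add, mul_add, smul_mul_smul_comm, mul_smul_comm,
        smul_mul_assoc]
      abel
    rw [h'] at h
    simpa [he, ← ha, ← hb, ← hc] using h
  have hc0 : 0 ≤ c := hτ.nonneg w
  rw [Complex.nonneg_iff] at hc0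
  simp only [Complex.nonneg_iff] at key
  -- The imaginary parts at `l = 1` and `l = i` force `b` to be the conjugate of `a`.
  have h1 := (key 1).2
  have hI := (key Complex.I).2
  simp [← hc0.2] at h1 hI
  have hba : b = star a := by
    apply Complex.ext
    · simp; linarith
    · simp; linarith
  -- The factor `(1 + c)⁻¹` rather than `c⁻¹` covers `c = 0`. With `t = (1 + c)⁻¹` the inequality
  -- becomes `-t(2 - tc)|a|² ≥ 0`, where `tc ≤ 1`.
  have ht := (key (-(((1 + c.re)⁻¹ : ℝ) : ℂ) * star a)).1
  rw [hba] at ht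
  have hpos : 0 < 1 + c.re := by linarith [hc0.1]
  set t : ℝ := (1 + c.re)⁻¹ with htdef
  have htpos : 0 < t := inv_pos.2 hpos
  have htc : t * c.re ≤ 1 := by
    rw [htdef, inv_mul_le_iff₀ hpos]; linarith
  have e : (-(t : ℂ) * star a * a + star (-(t : ℂ) * star a) * star a +
      star (-(t : ℂ) * star a) * (-(t : ℂ) * star a) * c).re =
      -(t * (2 - t * c.re)) * (a.re * a.re + a.im * a.im) := by
    simp [← hc0.2]
    ring
  rw [e] at ht
  have h2 : 0 < t * (2 - t * c.re) := mul_pos htpos (by linarith)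
  have h3 : a.re * a.re + a.im * a.im ≤ 0 := by
    by_contra h
    nlinarith [mul_pos h2 (not_le.1 h)]
  apply Complex.ext
  · simp; nlinarith [mul_self_nonneg a.re, mul_self_nonneg a.im]
  · simp; nlinarith [mul_self_nonneg a.re, mul_self_nonneg a.im]

/-- A normal tracial state of a factor is faithful. -/
theorem IsNormalTracialState.faithful (hτ : M.IsNormalTracialState τ)
    (hM : ∀ x ∈ M, x ∈ M.commutant → ∃ c : ℂ, x = c • (1 : H →L[ℂ] H))
    {e : M.toStarSubalgebra} (he : τ (star e * e) = 0) : e = 0 := by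
  -- The null space of the trace form: a two-sided ideal by traciality, with weak-operator closed
  -- unit ball by normality.
  let N : Submodule ℂ M.toStarSubalgebra :=
    { carrier := {z | ∀ y, τ (y * z) = 0}
      add_mem' := fun {a b} ha hb y => by rw [mul_add, map_add, ha, hb, add_zero]
      zero_mem' := fun y => by rw [mul_zero, map_zero]
      smul_mem' := fun c x hx y => by rw [mul_smul_comm, map_smul, hx, smul_zero] }
  have hNl : ∀ x, ∀ z ∈ N, x * z ∈ N := fun x z hz y => by rw [← mul_assoc]; exact hz _
  have hNr : ∀ x, ∀ z ∈ N, z * x ∈ N := fun x z hz y => by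
    rw [← mul_assoc, hτ.tracial, ← mul_assoc]; exact hz _
  have heN : star e ∈ N := fun y => by
    rw [hτ.tracial]; exact hτ.map_mul_eq_zero he y
  let X : Submodule ℂ (H →L[ℂ] H) := N.map M.toStarSubalgebra.subtype.toAlgHom.toLinearMap
  have hXM : ∀ x, x ∈ X ↔ ∃ hx : x ∈ M.toStarSubalgebra, ⟨x, hx⟩ ∈ N := fun x => by
    constructor
    · rintro ⟨z, hz, rfl⟩
      exact ⟨z.2, hz⟩
    · rintro ⟨hx, hz⟩
      exact ⟨_, hz, rfl⟩
  have hX : ∀ (U : Ultrafilter (H →L[ℂ] H)) (T : H →L[ℂ] H),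
      (∀ᶠ S in (U : Filter (H →L[ℂ] H)), S ∈ X) →
      (∀ᶠ S in (U : Filter (H →L[ℂ] H)), ‖S‖ ≤ 1) →
      WeakOperatorTendsto (U : Filter (H →L[ℂ] H)) T → T ∈ X := by
    intro U T hU hU1 hT
    have hTM : T ∈ M := hT.mem M (hU.mono fun S hS => ((hXM S).1 hS).1)
    refine (hXM T).2 ⟨hTM, fun y => ?_⟩
    have h1 := hT.map_mul_mul y 1
    rw [mul_one] at h1
    refine eq_zero_of_weakOperatorTendsto M τ hτ.normal h1 (r := ‖(y : H →L[ℂ] H)‖) ?_ ?_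
      (mul_mem y.2 hTM)
    · rw [eventually_map]
      filter_upwards [hU1] with S hS
      rw [mul_one]
      exact (norm_mul_le _ _).trans (mul_le_of_le_one_right (norm_nonneg _) hS)
    · rw [eventually_map]
      filter_upwards [hU] with S hS
      obtain ⟨hS', hS0⟩ := (hXM S).1 hS
      rw [mul_one]
      exact ⟨mul_mem y.2 hS', hS0 y⟩
  have hmul : ∀ x ∈ X, ∀ y ∈ X, ∀ z ∈ X, x * star y * z ∈ X := by
    rintro _ ⟨x, hx, rfl⟩ _ ⟨y, hy, rfl⟩ _ ⟨z, hz, rfl⟩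
    exact ⟨x * star y * z, hNl _ _ hz, rfl⟩
  obtain ⟨_, ⟨w, hwN, rfl⟩, -, hmax⟩ := exists_maximal_partialIsometry X hX hmul
  replace hmax : ∀ x ∈ N, (1 - (w : H →L[ℂ] H) * star (w : H →L[ℂ] H)) * x *
      (1 - star (w : H →L[ℂ] H) * w) = 0 := fun x hx => hmax x ⟨x, hx, rfl⟩
  by_contra he0
  have h1N : (1 : M.toStarSubalgebra) ∉ N := fun h => by
    have := h 1
    rw [mul_one, hτ.map_one] at this
    exact one_ne_zero this
  -- A vanishing defect of `w` would put `1` in the ideal, contradicting `τ 1 = 1`.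
  have hw1 : (1 - (w : H →L[ℂ] H) * star (w : H →L[ℂ] H)) ≠ 0 := fun h => by
    apply h1N
    have : w * star w = 1 := Subtype.ext (sub_eq_zero.1 h).symm
    rw [← this]
    exact hNr _ _ hwN
  have hw2 : (1 - star (w : H →L[ℂ] H) * w) ≠ 0 := fun h => by
    apply h1N
    have : star w * w = 1 := Subtype.ext (sub_eq_zero.1 h).symm
    rw [← this]
    exact hNl _ _ hwN
  -- As `e* ∈ N` and `N` is an ideal, `(1 - w w*) x e* y (1 - w* w) = 0` for all `x`, `y` in `M`.
  -- Cancelling the nonzero defects one after the other leaves `e* = 0`.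
  have h3 : ∀ y ∈ M, (star e : M.toStarSubalgebra).1 * y * (1 - star (w : H →L[ℂ] H) * w) = 0 := by
    intro y hy
    have h := eq_zero_or_eq_zero_of_mul_mul_eq_zero hM
      (e := 1 - (w : H →L[ℂ] H) * star (w : H →L[ℂ] H))
      (f := (star e : M.toStarSubalgebra).1 * y * (1 - star (w : H →L[ℂ] H) * w))
      (mul_mem (mul_mem (star e : M.toStarSubalgebra).2 hy)
        (sub_mem (one_mem M) (mul_mem (star_mem w.2) w.2))) (fun x hx => by
        have := hmax (⟨x, hx⟩ * star e * ⟨y, hy⟩) (hNr _ _ (hNl _ _ heN))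
        simpa [mul_assoc] using this)
    exact h.resolve_left hw1
  have h4 := eq_zero_or_eq_zero_of_mul_mul_eq_zero hM
    (sub_mem (one_mem M) (mul_mem (star_mem w.2) w.2)) h3
  refine he0 (star_eq_zero.1 (Subtype.ext (h4.resolve_right hw2)))

/-- In a factor with a normal tracial state, a projection of smaller trace is equivalent to a
subprojection. -/
theorem IsNormalTracialState.exists_partialIsometry (hτ : M.IsNormalTracialState τ)
    (hM : ∀ x ∈ M, x ∈ M.commutant → ∃ c : ℂ, x = c • (1 : H →L[ℂ] H))
    {p q : M.toStarSubalgebra} (hp : IsStarProjection p) (hq : IsStarProjection q)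
    (hpq : (τ p).re ≤ (τ q).re) :
    ∃ w : M.toStarSubalgebra, star w * w = p ∧ q * w = w := by
  obtain ⟨w, hw, hqw, hwp, h⟩ := exists_partialIsometry_of_factor hM p.2 q.2
    (hp.map M.toStarSubalgebra.subtype) (hq.map M.toStarSubalgebra.subtype)
  lift w to M.toStarSubalgebra using hw
  replace hqw : q * w = w := Subtype.ext hqw
  replace hwp : w * p = w := Subtype.ext hwp
  refine ⟨w, ?_, hqw⟩
  rcases h with h | h
  · exact Subtype.ext h
  replace h : w * star w = q := Subtype.ext h
  have hpp := hp.isIdempotentElem.eq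
  have hps : star p = p := hp.isSelfAdjoint
  have hpw : p * star w = star w := by
    simpa [hps] using congrArg star hwp
  have hd : star (p - star w * w) * (p - star w * w) = p - star w * w := by
    have h1 : star w * w * (star w * w) = star w * w := by
      rw [mul_assoc, ← mul_assoc w, h, hqw]
    rw [star_sub, hps, star_mul, star_star, sub_mul, mul_sub, mul_sub, hpp, h1,
      ← mul_assoc p, hpw, mul_assoc (star w) w p, hwp]
    abel
  -- When `w` exhausts `q`, the projection `p - w* w` has trace `τ p - τ q ≤ 0`, so it is zero by
  -- faithfulness.
  have h0 := hτ.nonneg (p - star w * w)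
  rw [hd, map_sub, hτ.tracial, h, Complex.nonneg_iff] at h0
  have hz : τ (star (p - star w * w) * (p - star w * w)) = 0 := by
    rw [hd, map_sub, hτ.tracial (star w), h]
    apply Complex.ext
    · have := h0.1
      simp only [Complex.sub_re] at this ⊢
      simp; linarith
    · exact h0.2.symm
  exact (sub_eq_zero.1 (hτ.faithful hM hz)).symm

theorem mul_eq_self_of_star_mul_self {P V : M.toStarSubalgebra} (hP : IsStarProjection P)
    (hV : star V * V = P) : V * P = V := by
  have hpp := hP.isIdempotentElem.eq
  have hps : star P = P := hP.isSelfAdjoint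
  have h0 : star (V - V * P) * (V - V * P) = 0 := by
    rw [star_sub, star_mul, hps, sub_mul, mul_sub, mul_sub, hV, ← mul_assoc, hV, mul_assoc, hV,
      mul_assoc, ← mul_assoc (star V), hV, hpp, hpp]
    simp
  have h1 := congrArg Subtype.val h0
  have h2 : (V - V * P).1 = 0 := (CStarRing.star_mul_self_eq_zero_iff (V - V * P).1).1 h1
  exact (sub_eq_zero.1 (Subtype.ext h2 : V - V * P = 0)).symm

theorem isStarProjection_one_sub_sum {k : ℕ} {P : M.toStarSubalgebra} (hP : IsStarProjection P)
    (V : Fin k → M.toStarSubalgebra) (hV : ∀ i j, star (V i) * V j = if i = j then P else 0) :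
    IsStarProjection (1 - ∑ i, V i * star (V i)) ∧
      ∀ j, (1 - ∑ i, V i * star (V i)) * V j = 0 := by
  have h1 : ∀ j, (1 - ∑ i, V i * star (V i)) * V j = 0 := by
    intro j
    rw [sub_mul, one_mul, Finset.sum_mul]
    simp only [mul_assoc, hV, mul_ite, mul_zero, Finset.sum_ite_eq',
      Finset.mem_univ, if_true]
    rw [mul_eq_self_of_star_mul_self hP (by rw [hV, if_pos rfl]), sub_self]
  refine ⟨⟨?_, ?_⟩, h1⟩
  · change _ * _ = _
    conv_lhs => rw [mul_sub, mul_one, Finset.mul_sum]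
    simp only [← mul_assoc, h1, zero_mul, Finset.sum_const_zero, sub_zero]
  · change star _ = _
    simp [star_sum]

/-- A projection of trace `1 / n` is part of a system of `n` equivalent orthogonal projections
with sum `1`. -/
theorem IsNormalTracialState.exists_matrixUnits (hτ : M.IsNormalTracialState τ)
    (hM : ∀ x ∈ M, x ∈ M.commutant → ∃ c : ℂ, x = c • (1 : H →L[ℂ] H))
    {n : ℕ} (hn : 1 ≤ n) {P : M.toStarSubalgebra} (hP : IsStarProjection P)
    (hPn : τ P = 1 / (n : ℂ)) :
    ∃ V : Fin n → M.toStarSubalgebra, (∀ i j, star (V i) * V j = if i = j then P else 0) ∧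
      ∑ i, V i * star (V i) = 1 := by
  have hn0 : (n : ℝ) ≠ 0 := by positivity
  have hPn' : τ P = ((1 / n : ℝ) : ℂ) := by rw [hPn]; push_cast; rfl
  have htr : ∀ k : ℕ, ∀ V : Fin k → M.toStarSubalgebra,
      (∀ i j, star (V i) * V j = if i = j then P else 0) →
      τ (1 - ∑ i, V i * star (V i)) = ((1 - k / n : ℝ) : ℂ) := by
    intro k V hV
    rw [map_sub, map_sum, hτ.map_one]
    simp only [hτ.tracial (V _), hV, if_true, hPn']
    simp
    ring
  have hex : ∀ k ≤ n, ∃ V : Fin k → M.toStarSubalgebra,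
      ∀ i j, star (V i) * V j = if i = j then P else 0 := by
    intro k
    induction k with
    | zero => exact fun _ => ⟨Fin.elim0, fun i => i.elim0⟩
    | succ k ih =>
      intro hk
      obtain ⟨V, hV⟩ := ih (by omega)
      obtain ⟨hr, hrV⟩ := isStarProjection_one_sub_sum hP V hV
      -- The complement of `k` copies has trace `1 - k/n ≥ 1/n` because `k + 1 ≤ n`: there is room
      -- for one more copy of `P`.
      obtain ⟨w, hw, hrw⟩ := hτ.exists_partialIsometry hM hP hr (by
        rw [htr k V hV, hPn', Complex.ofReal_re, Complex.ofReal_re]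
        have : (k : ℝ) + 1 ≤ n := by exact_mod_cast hk
        rw [le_sub_iff_add_le, ← add_div, div_le_one (by positivity)]
        linarith)
      have hwV : ∀ j, star w * V j = 0 := fun j => by
        rw [← hrw, star_mul, hr.isSelfAdjoint.star_eq, mul_assoc, hrV, mul_zero]
      have hVw : ∀ j, star (V j) * w = 0 := fun j => by
        simpa using congrArg star (hwV j)
      refine ⟨Fin.cons w V, fun i j => ?_⟩
      refine Fin.cases ?_ (fun i => ?_) i <;> refine Fin.cases ?_ (fun j => ?_) j
      · simpa using hw
      · simp only [Fin.cons_zero, Fin.cons_succ, hwV]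
        rw [if_neg (Fin.succ_ne_zero j).symm]
      · simp only [Fin.cons_zero, Fin.cons_succ, hVw]
        rw [if_neg (Fin.succ_ne_zero i)]
      · simp only [Fin.cons_succ, hV, Fin.succ_inj]
  obtain ⟨V, hV⟩ := hex n le_rfl
  refine ⟨V, hV, ?_⟩
  obtain ⟨hr, -⟩ := isStarProjection_one_sub_sum hP V hV
  have h0 := htr n V hV
  rw [div_self hn0, sub_self, Complex.ofReal_zero] at h0
  refine (sub_eq_zero.1 (hτ.faithful hM (e := 1 - ∑ i, V i * star (V i)) ?_)).symm
  rw [hr.isSelfAdjoint.star_eq, hr.isIdempotentElem.eq, h0]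

end VonNeumannAlgebra

/-! ### Similarity as a positive intertwiner -/

section Similarity

variable {K : Type v} [NormedAddCommGroup K] [InnerProductSpace ℂ K] [CompleteSpace K]

/-- A homomorphism into `B(K)` is similar to a `*`-homomorphism if and only if it is a
`*`-homomorphism for the involution twisted by a positive invertible operator. -/
theorem similar_starAlgHom_iff {R : Type*} [Ring R] [StarRing R] [Algebra ℂ R]
    (φ : R →ₐ[ℂ] (K →L[ℂ] K)) :
    (∃ (S : (K →L[ℂ] K)ˣ) (π : R →⋆ₐ[ℂ] (K →L[ℂ] K)),
      ∀ x, π x = (↑S⁻¹ : K →L[ℂ] K) * φ x * (S : K →L[ℂ] K)) ↔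
    ∃ A : (K →L[ℂ] K)ˣ, 0 ≤ (A : K →L[ℂ] K) ∧
      ∀ x, φ (star x) * A = A * star (φ x) := by
  constructor
  · rintro ⟨S, π, h⟩
    -- The intertwiner is `A = S S*`; conversely `S` is recovered as the positive square root of
    -- `A`.
    refine ⟨S * star S, ?_, fun x => ?_⟩
    · rw [Units.val_mul, Units.coe_star]
      exact mul_star_self_nonneg _
    · have h1 : ∀ x, φ x = S * π x * (↑S⁻¹ : K →L[ℂ] K) := fun x => by
        rw [h]
        simp [mul_assoc]
      have h2 : star (S : K →L[ℂ] K) * star (↑S⁻¹ : K →L[ℂ] K) = 1 := by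
        rw [← star_mul, Units.inv_mul, star_one]
      rw [h1, h1 x, map_star, Units.val_mul, Units.coe_star, star_mul, star_mul]
      simp only [mul_assoc, Units.inv_mul_cancel_left]
      rw [← mul_assoc (star (S : K →L[ℂ] K)), h2, one_mul]
  · rintro ⟨A, hA, h⟩
    have hs : IsUnit (CFC.sqrt (A : K →L[ℂ] K)) := (CFC.isUnit_sqrt_iff _ hA).2 A.isUnit
    obtain ⟨S, hS⟩ := hs
    have hSs : star (S : K →L[ℂ] K) = S := by
      rw [hS]
      exact (CFC.sqrt_nonneg (A : K →L[ℂ] K)).isSelfAdjoint.star_eq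
    have hSi : star (↑S⁻¹ : K →L[ℂ] K) = (↑S⁻¹ : K →L[ℂ] K) := by
      have : star S = S := Units.ext hSs
      rw [← Units.coe_star, star_inv, this]
    have hSA : A = S * S := Units.ext (by
      rw [Units.val_mul, hS, CFC.sqrt_mul_sqrt_self _ hA])
    let π₀ : R →ₐ[ℂ] (K →L[ℂ] K) := AlgHom.ofLinearMap
      ((LinearMap.mulLeftRight ℂ ((↑S⁻¹ : K →L[ℂ] K), (S : K →L[ℂ] K))) ∘ₗ φ.toLinearMap)
      (by simp) (fun x y => by simp [mul_assoc])
    have hπ : ∀ x, π₀ x = (↑S⁻¹ : K →L[ℂ] K) * φ x * (S : K →L[ℂ] K) := fun x => by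
      simp [π₀]
    refine ⟨S, { π₀ with map_star' := fun x => ?_ }, hπ⟩
    change π₀ (star x) = star (π₀ x)
    have hx := h x
    rw [hSA, Units.val_mul] at hx
    have h3 : φ (star x) * S = S * S * star (φ x) * (↑S⁻¹ : K →L[ℂ] K) := by
      rw [← hx]
      simp [mul_assoc]
    rw [hπ, hπ, star_mul, star_mul, hSs, hSi, mul_assoc, h3]
    simp [mul_assoc]

end Similarity

/-! ### Operations preserving w*-continuity -/

section WeakStarContinuity

variable {H : Type*} [NormedAddCommGroup H] [InnerProductSpace ℂ H]
  {K : Type*} [NormedAddCommGroup K] [InnerProductSpace ℂ K]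
  {X : Type*} [TopologicalSpace X]

theorem continuous_weakStar_iff {f : X → (H →L[ℂ] H)} :
    @Continuous _ _ _ (weakStarTopology H) f ↔
      ∀ ξ η : lp (fun _ : ℕ => H) 2, Continuous fun x => normalEval ξ η (f x) := by
  simp only [continuous_iInf_rng, continuous_induced_rng]
  rfl

theorem continuous_weakStar_sum {ι : Type*} (s : Finset ι) {f : ι → X → (H →L[ℂ] H)}
    (hf : ∀ i ∈ s, @Continuous _ _ _ (weakStarTopology H) (f i)) :
    @Continuous _ _ _ (weakStarTopology H) fun x => ∑ i ∈ s, f i x := by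
  refine continuous_weakStar_iff.2 fun ξ η => ?_
  have hs : ∀ T : H →L[ℂ] H, Summable fun i => (inner ℂ (ξ i) (T (η i)) : ℂ) := fun T =>
    lp.summable_inner ξ (lp.mapCLM 2 (fun _ => T) (norm_nonneg T) (fun _ => le_rfl) η)
  have h : ∀ x, normalEval ξ η (∑ i ∈ s, f i x) = ∑ i ∈ s, normalEval ξ η (f i x) := fun x => by
    simp only [normalEval, sum_apply, inner_sum]
    exact Summable.tsum_finsetSum fun i _ => hs _
  simp only [h]
  exact continuous_finsetSum s fun i hi => continuous_weakStar_iff.1 (hf i hi) ξ η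

theorem continuous_weakStar_comp_comp [CompleteSpace H] [CompleteSpace K] (a : H →L[ℂ] K)
    (b : K →L[ℂ] H) {f : X → (H →L[ℂ] H)} (hf : @Continuous _ _ _ (weakStarTopology H) f) :
    @Continuous _ _ _ (weakStarTopology K) fun x => a ∘L f x ∘L b := by
  refine continuous_weakStar_iff.2 fun ξ η => ?_
  have h := continuous_weakStar_iff.1 hf
    (lp.mapCLM 2 (fun _ => adjoint a) (norm_nonneg _) (fun _ => le_rfl) ξ)
    (lp.mapCLM 2 (fun _ => b) (norm_nonneg _) (fun _ => le_rfl) η)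
  refine h.congr fun x => ?_
  simp only [normalEval]
  refine tsum_congr fun i => ?_
  exact adjoint_inner_left a _ _

end WeakStarContinuity

theorem norm_comp_comp_le {E F : Type*} [NormedAddCommGroup E] [InnerProductSpace ℂ E]
    [NormedAddCommGroup F] [InnerProductSpace ℂ F] (a : E →L[ℂ] F) (b : F →L[ℂ] E)
    (T : E →L[ℂ] E) : ‖a ∘L T ∘L b‖ ≤ ‖a‖ * ‖b‖ * ‖T‖ := by
  calc ‖a ∘L T ∘L b‖ ≤ ‖a‖ * (‖T‖ * ‖b‖) :=
        (opNorm_comp_le _ _).trans (by gcongr; exact opNorm_comp_le _ _)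
    _ = _ := by ring

/-! ### Inclusion and compression for the corner -/

namespace VonNeumannAlgebra

section CornerMaps

variable {H : Type*} [NormedAddCommGroup H] [InnerProductSpace ℂ H] [CompleteSpace H]
  {H' : Type*} [NormedAddCommGroup H'] [InnerProductSpace ℂ H'] [CompleteSpace H']

theorem continuous_mul_mul {M : VonNeumannAlgebra H} (a b : M.toStarSubalgebra) :
    @Continuous _ _ M.weakStar M.weakStar fun x => a * x * b := by
  let _ := M.weakStar
  exact continuous_induced_rng.2 (continuous_weakStar_comp_comp (X := M.toStarSubalgebra)
    (a : H →L[ℂ] H) (b : H →L[ℂ] H) (@continuous_induced_dom _ _ _ (weakStarTopology _)))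

/-- An identification of a von Neumann algebra `N` with the corner of `M` at `P`. -/
structure CornerMaps (M : VonNeumannAlgebra H) (P : M.toStarSubalgebra)
    (N : VonNeumannAlgebra H') where
  /-- The inclusion `PMP → M`. -/
  incl : N.toStarSubalgebra →ₗ[ℂ] M.toStarSubalgebra
  /-- The compression `M → PMP`, `x ↦ PxP`. -/
  compress : M.toStarSubalgebra →ₗ[ℂ] N.toStarSubalgebra
  incl_compress : ∀ x, incl (compress x) = P * x * P
  compress_incl : ∀ y, compress (incl y) = y
  incl_mul : ∀ x y, incl (x * y) = incl x * incl y
  incl_one : incl 1 = P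
  incl_star : ∀ x, incl (star x) = star (incl x)
  continuous_incl : @Continuous _ _ N.weakStar M.weakStar incl
  continuous_compress : @Continuous _ _ M.weakStar N.weakStar compress
  norm_incl_le : ∃ C : ℝ, 0 ≤ C ∧
    ∀ x, ‖(incl x : H →L[ℂ] H)‖ ≤ C * ‖(x : H' →L[ℂ] H')‖
  norm_compress_le : ∃ C : ℝ, 0 ≤ C ∧
    ∀ x, ‖(compress x : H' →L[ℂ] H')‖ ≤ C * ‖(x : H →L[ℂ] H)‖

/-- The inclusion and compression maps of the corner `PMP`. -/
def cornerMaps {H : Type u} [NormedAddCommGroup H] [InnerProductSpace ℂ H] [CompleteSpace H]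
    (M : VonNeumannAlgebra H) (P : M.toStarSubalgebra) (hP : IsStarProjection P) :
    CornerMaps M P (M.corner P hP) where
  incl :=
    { toFun := fun T => ⟨extendByZero (P : H →L[ℂ] H) T, T.2⟩
      map_add' := fun _ _ => Subtype.ext (extendByZero_add _ _ _)
      map_smul' := fun _ _ => Subtype.ext (extendByZero_smul _ _ _) }
  compress :=
    { toFun := fun x => ⟨_root_.compress (P : H →L[ℂ] H) x, (M.mem_corner_iff P hP _).2
        ⟨x, x.2, extendByZero_compress (hP.map M.toStarSubalgebra.subtype) _⟩⟩
      map_add' := fun x y => Subtype.ext (by ext; simp [_root_.compress])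
      map_smul' := fun c x => Subtype.ext (by ext; simp [_root_.compress]) }
  incl_compress x := Subtype.ext (extendByZero_compress (hP.map M.toStarSubalgebra.subtype) _)
  compress_incl y := Subtype.ext (compress_extendByZero _ _)
  incl_mul x y := Subtype.ext (extendByZero_mul _ _ _)
  incl_one := Subtype.ext (extendByZero_one (hP.map M.toStarSubalgebra.subtype))
  incl_star x := Subtype.ext (extendByZero_star _ _)
  continuous_incl := by
    let _ := (M.corner P hP).weakStar
    exact continuous_induced_rng.2 (continuous_weakStar_comp_comp
      (X := (M.corner P hP).toStarSubalgebra) _ _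
      (@continuous_induced_dom _ _ _ (weakStarTopology _)))
  continuous_compress := by
    let _ := M.weakStar
    exact continuous_induced_rng.2 (continuous_weakStar_comp_comp (X := M.toStarSubalgebra) _ _
      (@continuous_induced_dom _ _ _ (weakStarTopology _)))
  norm_incl_le := ⟨_, by positivity, fun _ => norm_comp_comp_le _ _ _⟩
  norm_compress_le := ⟨_, by positivity, fun _ => norm_comp_comp_le _ _ _⟩

namespace CornerMaps

variable {M : VonNeumannAlgebra H} {P : M.toStarSubalgebra} {N : VonNeumannAlgebra H'}
  (κ : CornerMaps M P N)

theorem incl_injective : Function.Injective κ.incl :=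
  Function.LeftInverse.injective κ.compress_incl

theorem compress_mul (hP : IsStarProjection P) (x y : M.toStarSubalgebra) :
    κ.compress x * κ.compress y = κ.compress (x * P * y) := by
  apply κ.incl_injective
  rw [κ.incl_mul, κ.incl_compress, κ.incl_compress, κ.incl_compress]
  simp only [mul_assoc]
  rw [← mul_assoc P P, hP.isIdempotentElem.eq]

theorem compress_self : κ.compress P = 1 :=
  (congrArg κ.compress κ.incl_one.symm).trans (κ.compress_incl 1)

end CornerMaps

end CornerMaps

end VonNeumannAlgebra

/-! ### Extending intertwiners along matrix units -/

section MatrixUnits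

variable {K : Type v} [NormedAddCommGroup K] [InnerProductSpace ℂ K] [CompleteSpace K]

/-- An intertwiner between a homomorphism and its adjoint on a corner extends to the whole
algebra along matrix units. -/
theorem exists_intertwiner_of_corner {R : Type*} [Ring R] [StarRing R] [Algebra ℂ R]
    (φ : R →ₐ[ℂ] (K →L[ℂ] K)) {P : R} (hP : IsStarProjection P) {n : ℕ} (V : Fin n → R)
    (hV : ∀ i j, star (V i) * V j = if i = j then P else 0) (hVP : ∀ i, V i * P = V i)
    (hsum : ∑ i, V i * star (V i) = 1)
    (a b : K →L[ℂ] K) (ha : 0 ≤ a) (hPa : φ P * a = a) (hab : a * b = φ P)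
    (h : ∀ x, P * x * P = x → φ (star x) * a = a * star (φ x)) :
    ∃ A : (K →L[ℂ] K)ˣ, 0 ≤ (A : K →L[ℂ] K) ∧ ∀ x, φ (star x) * A = A * star (φ x) := by
  have has : star a = a := ha.isSelfAdjoint.star_eq
  have hPs : star P = P := hP.isSelfAdjoint
  have hPV : ∀ i, P * star (V i) = star (V i) := fun i => by
    simpa [hPs] using congrArg star (hVP i)
  have haP : a * star (φ P) = a := by simpa [has] using congrArg star hPa
  set A : K →L[ℂ] K := ∑ i, φ (V i) * a * star (φ (V i)) with hA
  set B : K →L[ℂ] K := ∑ i, star (φ (star (V i))) * b * φ (star (V i)) with hB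
  have hA0 : 0 ≤ A := Finset.sum_nonneg fun i _ => star_right_conjugate_nonneg ha _
  have hAB : A * B = 1 := by
    rw [hA, hB, Finset.sum_mul_sum]
    have h1 : ∀ i j, φ (V i) * a * star (φ (V i)) * (star (φ (star (V j))) * b * φ (star (V j))) =
        if j = i then φ (V i * star (V i)) else 0 := by
      intro i j
      have h2 : star (φ (V i)) * star (φ (star (V j))) = star (φ (star (V j) * V i)) := by
        rw [map_mul, star_mul]
      calc _ = φ (V i) * a * (star (φ (V i)) * star (φ (star (V j)))) * b * φ (star (V j)) := by
            simp only [mul_assoc]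
        _ = _ := by
            rw [h2, hV]
            split_ifs with hij
            · rw [mul_assoc (φ (V i)), haP, mul_assoc (φ (V i)), hab, ← map_mul, ← map_mul, hVP, hij]
            · simp
    simp only [h1, Finset.sum_ite_eq', Finset.mem_univ, if_true]
    rw [← map_sum, hsum, map_one]
  -- Nothing is assumed about `b*`: since `A` is self-adjoint, `B*` is a left inverse of `A`, hence
  -- equals the right inverse `B`.
  have hBA : star B * A = 1 := by
    simpa [hA0.isSelfAdjoint.star_eq] using congrArg star hAB
  have hBB : star B = B := left_inv_eq_right_inv hBA hAB
  refine ⟨⟨A, B, hAB, by rwa [hBB] at hBA⟩, hA0, fun x => ?_⟩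
  change φ (star x) * A = A * star (φ x)
  -- Inserting `∑ V j V j* = 1` reduces the action of `x*` to the corner elements `V i* x V j`,
  -- where the hypothesis applies.
  have h1 : ∀ i, φ (star x) * φ (V i) * a =
      ∑ j, φ (V j) * a * star (φ (star (V i) * x * V j)) := by
    intro i
    have h2 : star x * V i = ∑ j, V j * star (star (V i) * x * V j) := by
      simp only [star_mul, star_star, ← mul_assoc]
      rw [← Finset.sum_mul, ← Finset.sum_mul, hsum, one_mul]
    rw [← map_mul, h2, map_sum, Finset.sum_mul]
    refine Finset.sum_congr rfl fun j _ => ?_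
    rw [map_mul, mul_assoc, h, ← mul_assoc]
    rw [mul_assoc, mul_assoc, hVP, ← mul_assoc, ← mul_assoc, hPV]
  calc φ (star x) * A = ∑ i, ∑ j, φ (V j) * a * star (φ (V i * star (V i) * x * V j)) := by
        rw [hA, Finset.mul_sum]
        refine Finset.sum_congr rfl fun i _ => ?_
        rw [← mul_assoc, ← mul_assoc, h1, Finset.sum_mul]
        refine Finset.sum_congr rfl fun j _ => ?_
        rw [mul_assoc (φ (V j) * a), ← star_mul, ← map_mul]
        simp only [mul_assoc]
    _ = ∑ j, φ (V j) * a * star (φ (x * V j)) := by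
        rw [Finset.sum_comm]
        refine Finset.sum_congr rfl fun j _ => ?_
        rw [← Finset.mul_sum, ← star_sum, ← map_sum, ← Finset.sum_mul, ← Finset.sum_mul, hsum,
          one_mul]
    _ = A * star (φ x) := by
        rw [hA, Finset.sum_mul]
        refine Finset.sum_congr rfl fun j _ => ?_
        rw [map_mul, star_mul, mul_assoc, mul_assoc, mul_assoc]

/-- A positive invertible operator on a complemented subspace, transported to the whole space. -/
theorem comp_adjoint_mul_adjoint_comp {L : Type*} [NormedAddCommGroup L] [InnerProductSpace ℂ L]
    [CompleteSpace L] {ι : L →L[ℂ] K} {ρ : K →L[ℂ] L} (hρι : ρ ∘L ι = 1) (A : (L →L[ℂ] L)ˣ) :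
    (ι ∘L (A : L →L[ℂ] L) ∘L adjoint ι) * (adjoint ρ ∘L (↑A⁻¹ : L →L[ℂ] L) ∘L ρ) = ι ∘L ρ := by
  have hadj : adjoint ι ∘L adjoint ρ = 1 := by
    rw [← adjoint_comp, hρι]
    exact star_one _
  calc _ = ι ∘L ((A : L →L[ℂ] L) ∘L ((adjoint ι ∘L adjoint ρ) ∘L (↑A⁻¹ : L →L[ℂ] L))) ∘L ρ := rfl
    _ = ι ∘L ((A : L →L[ℂ] L) * (1 * ↑A⁻¹)) ∘L ρ := by rw [hadj]; rfl
    _ = ι ∘L ρ := by rw [one_mul, Units.mul_inv]; rfl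

theorem mul_comp_adjoint_eq {L : Type*} [NormedAddCommGroup L] [InnerProductSpace ℂ L]
    [CompleteSpace L] {ι : L →L[ℂ] K} {A S S' : L →L[ℂ] L} {T T' : K →L[ℂ] K}
    (hT : T ∘L ι = ι ∘L S) (hT' : T' ∘L ι = ι ∘L S') (h : S' * A = A * star S) :
    T' * (ι ∘L A ∘L adjoint ι) = (ι ∘L A ∘L adjoint ι) * star T := by
  have h2 : adjoint ι ∘L adjoint T = adjoint S ∘L adjoint ι := by
    rw [← adjoint_comp, hT, adjoint_comp]
  calc _ = (T' ∘L ι) ∘L A ∘L adjoint ι := rfl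
    _ = ι ∘L (S' * A) ∘L adjoint ι := by rw [hT']; rfl
    _ = ι ∘L A ∘L (adjoint S ∘L adjoint ι) := by rw [h]; rfl
    _ = _ := by rw [← h2]; rfl

/-- Positive intertwiners extend from the compression of a homomorphism to a corner. -/
theorem exists_intertwiner_of_compression {R : Type*} [Ring R] [StarRing R] [Algebra ℂ R]
    (φ : R →ₐ[ℂ] (K →L[ℂ] K)) {P : R} (hP : IsStarProjection P) {n : ℕ} (V : Fin n → R)
    (hV : ∀ i j, star (V i) * V j = if i = j then P else 0) (hVP : ∀ i, V i * P = V i)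
    (hsum : ∑ i, V i * star (V i) = 1)
    {L : Type*} [NormedAddCommGroup L] [InnerProductSpace ℂ L] [CompleteSpace L]
    {ι : L →L[ℂ] K} {ρ : K →L[ℂ] L} (hρι : ρ ∘L ι = 1) (hιρ : ι ∘L ρ = φ P)
    (A : (L →L[ℂ] L)ˣ) (hA0 : 0 ≤ (A : L →L[ℂ] L))
    (hA : ∀ x, P * x * P = x → (ρ ∘L φ (star x) ∘L ι) * A = A * star (ρ ∘L φ x ∘L ι)) :
    ∃ A : (K →L[ℂ] K)ˣ, 0 ≤ (A : K →L[ℂ] K) ∧ ∀ x, φ (star x) * A = A * star (φ x) := by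
  have hpp := hP.isIdempotentElem.eq
  have hφι : ∀ x, P * x * P = x → φ x ∘L ι = ι ∘L (ρ ∘L φ x ∘L ι) := fun x hx => by
    rw [← comp_assoc, hιρ, ← comp_assoc]
    congr 1
    change _ = φ P * _
    rw [← map_mul, ← hx, ← mul_assoc, ← mul_assoc, hpp]
  refine exists_intertwiner_of_corner φ hP V hV hVP hsum
    (ι ∘L (A : L →L[ℂ] L) ∘L adjoint ι) (adjoint ρ ∘L (↑A⁻¹ : L →L[ℂ] L) ∘L ρ) ?_ ?_ ?_ ?_
  · rw [nonneg_iff_isPositive] at hA0 ⊢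
    exact hA0.conj_adjoint ι
  · rw [← hιρ]
    change ι ∘L (ρ ∘L ι) ∘L (A : L →L[ℂ] L) ∘L adjoint ι = _
    rw [hρι]
    rfl
  · rw [comp_adjoint_mul_adjoint_comp hρι, hιρ]
  · intro x hx
    refine mul_comp_adjoint_eq (hφι x hx) (hφι (star x) ?_) (hA x hx)
    conv_rhs => rw [← hx]
    simp [hP.isSelfAdjoint.star_eq, mul_assoc]

end MatrixUnits

/-! ### Transfer of WSP in both directions -/

namespace VonNeumannAlgebra

variable {H : Type*} [NormedAddCommGroup H] [InnerProductSpace ℂ H] [CompleteSpace H]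
  {H' : Type*} [NormedAddCommGroup H'] [InnerProductSpace ℂ H'] [CompleteSpace H']
  {M : VonNeumannAlgebra H} {P : M.toStarSubalgebra} {N : VonNeumannAlgebra H'}

/-- The idempotent `φ P` need not be self-adjoint. The corner therefore acts on its range `L`
through the possibly oblique factorisation `φ P = ι ρ`, `ρ ι = 1`, in which `ρ` need not be `ι*`. -/
theorem WSP.of_corner (κ : CornerMaps M P N) (hP : IsStarProjection P) {n : ℕ}
    (V : Fin n → M.toStarSubalgebra)
    (hV : ∀ i j, star (V i) * V j = if i = j then P else 0)
    (hsum : ∑ i, V i * star (V i) = 1) (hN : WSP.{_, v} N) : WSP.{_, v} M := by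
  intro K _ _ _ φ hφ ⟨C, hC⟩
  rw [similar_starAlgHom_iff]
  have hEE : φ P * φ P = φ P := by rw [← map_mul, hP.isIdempotentElem.eq]
  obtain ⟨L, _, _, _, ι, ρ, hιρ, hρι⟩ : ∃ (L : Type v) (_ : NormedAddCommGroup L)
      (_ : InnerProductSpace ℂ L) (_ : CompleteSpace L) (ι : L →L[ℂ] K) (ρ : K →L[ℂ] L),
      ι ∘L ρ = φ P ∧ ρ ∘L ι = 1 :=
    ⟨projSpace (φ P), inferInstance, inferInstance, inferInstance, (projSpace (φ P)).subtypeL,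
      (φ P).codRestrict _ fun x => congrArg (fun T : K →L[ℂ] K => T x) hEE, rfl,
      ContinuousLinearMap.ext fun x => Subtype.ext x.2⟩
  have hEι : φ P ∘L ι = ι := by
    rw [← hιρ, comp_assoc, hρι]
    rfl
  have hPincl : ∀ y, P * κ.incl y = κ.incl y := fun y => by
    conv_rhs => rw [← one_mul y, κ.incl_mul]
    rw [κ.incl_one]
  have hφι : ∀ y, ι ∘L (ρ ∘L φ (κ.incl y) ∘L ι) = φ (κ.incl y) ∘L ι := fun y => by
    rw [← comp_assoc, hιρ, ← comp_assoc]
    congr 1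
    change φ P * _ = _
    rw [← map_mul, hPincl]
  let ψ : N.toStarSubalgebra →ₐ[ℂ] (L →L[ℂ] L) :=
    AlgHom.ofLinearMap
      { toFun := fun y => ρ ∘L φ (κ.incl y) ∘L ι
        map_add' := fun x y => by simp
        map_smul' := fun c x => by simp }
      (by
        change ρ ∘L φ (κ.incl 1) ∘L ι = 1
        rw [κ.incl_one, hEι, hρι])
      (fun x y => by
        change ρ ∘L φ (κ.incl (x * y)) ∘L ι =
          (ρ ∘L φ (κ.incl x) ∘L ι) ∘L (ρ ∘L φ (κ.incl y) ∘L ι)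
        rw [comp_assoc, comp_assoc, hφι, κ.incl_mul, map_mul]
        rfl)
  have hψ : ∀ y, ψ y = ρ ∘L φ (κ.incl y) ∘L ι := fun y => rfl
  clear_value ψ
  obtain ⟨A, hA0, hA⟩ := (similar_starAlgHom_iff ψ).1 (hN _ ψ
    (by
      let _ := N.weakStar
      let _ := M.weakStar
      rw [show (ψ : N.toStarSubalgebra → _) = fun y => ρ ∘L φ (κ.incl y) ∘L ι from funext hψ]
      exact continuous_weakStar_comp_comp ρ ι
        (@Continuous.comp _ _ _ _ _ (weakStarTopology K) _ _ hφ κ.continuous_incl))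
    (by
      obtain ⟨D, hD, hD'⟩ := κ.norm_incl_le
      refine ⟨‖ρ‖ * ‖ι‖ * (|C| * D), fun x => ?_⟩
      rw [hψ]
      refine (norm_comp_comp_le _ _ _).trans ?_
      rw [mul_assoc (‖ρ‖ * ‖ι‖)]
      gcongr
      refine (hC _).trans ?_
      rw [mul_assoc]
      exact mul_le_mul (le_abs_self C) (hD' x) (norm_nonneg _) (abs_nonneg C)))
  refine exists_intertwiner_of_compression φ hP V hV
    (fun i => mul_eq_self_of_star_mul_self hP (by rw [hV, if_pos rfl])) hsum hρι hιρ A hA0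
    fun x hx => ?_
  have hx' : κ.incl (κ.compress x) = x := by rw [κ.incl_compress, hx]
  have h := hA (κ.compress x)
  rw [hψ, hψ, κ.incl_star, hx'] at h
  exact h

/-- A representation `φ` of the corner is amplified to `x ↦ (φ(V i* x V j))ᵢⱼ` on `Kⁿ`, which is
multiplicative because `∑ V j V j* = 1`. -/
theorem WSP.corner (κ : CornerMaps M P N) (hP : IsStarProjection P) {n : ℕ} (hn : 1 ≤ n)
    (V : Fin n → M.toStarSubalgebra)
    (hV : ∀ i j, star (V i) * V j = if i = j then P else 0)
    (hsum : ∑ i, V i * star (V i) = 1) (hM : WSP.{_, v} M) : WSP.{_, v} N := by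
  intro K _ _ _ φ hφ ⟨C, hC⟩
  rw [similar_starAlgHom_iff]
  have hVP : ∀ i, V i * P = V i :=
    fun i => mul_eq_self_of_star_mul_self hP (by rw [hV, if_pos rfl])
  let G := PiLp 2 fun _ : Fin n => K
  let ρ : Fin n → (G →L[ℂ] K) := fun i => PiLp.proj 2 (fun _ : Fin n => K) i
  let ι : Fin n → (K →L[ℂ] G) := fun i =>
    ((PiLp.continuousLinearEquiv 2 ℂ fun _ : Fin n => K).symm : (Fin n → K) →L[ℂ] G) ∘L
      ContinuousLinearMap.single ℂ (fun _ : Fin n => K) i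
  have hρι : ∀ i j, ρ i ∘L ι j = if i = j then 1 else 0 := by
    intro i j
    ext x
    change Pi.single (M := fun _ : Fin n => K) j x i = _
    split_ifs with hij
    · subst hij; simp
    · rw [Pi.single_eq_of_ne hij]; rfl
  have hιρ : ∑ i, ι i ∘L ρ i = 1 := by
    ext x i
    rw [sum_apply, WithLp.ofLp_sum, Finset.sum_apply]
    change ∑ j, Pi.single (M := fun _ : Fin n => K) j (x j) i = x i
    rw [Finset.sum_pi_single]
    simp
  have hadj : ∀ i, adjoint (ρ i) = ι i := by
    intro i
    symm
    rw [eq_adjoint_iff]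
    intro x y
    rw [PiLp.inner_apply]
    rw [Finset.sum_eq_single i]
    · change inner ℂ (Pi.single (M := fun _ : Fin n => K) i x i) _ = _
      rw [Pi.single_eq_same]
      rfl
    · intro j _ hj
      change inner ℂ (Pi.single (M := fun _ : Fin n => K) i x j) _ = _
      rw [Pi.single_eq_of_ne hj, inner_zero_left]
    · simp
  let e : Fin n → Fin n → M.toStarSubalgebra → (K →L[ℂ] K) :=
    fun i j x => φ (κ.compress (star (V i) * x * V j))
  have hmul : ∀ i k x y, ∑ j, e i j x * e j k y = e i k (x * y) := by
    intro i k x y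
    simp only [e, ← map_mul, κ.compress_mul hP]
    rw [← map_sum, ← map_sum]
    congr 2
    calc ∑ j, star (V i) * x * V j * P * (star (V j) * y * V k)
        = ∑ j, star (V i) * x * (V j * star (V j)) * (y * V k) := by
          refine Finset.sum_congr rfl fun j _ => ?_
          rw [mul_assoc (star (V i) * x), hVP]
          simp only [mul_assoc]
      _ = _ := by
          rw [← Finset.sum_mul, ← Finset.mul_sum, hsum]
          simp only [mul_assoc, mul_one]
  let Φ : M.toStarSubalgebra →ₐ[ℂ] (G →L[ℂ] G) := AlgHom.ofLinearMap
    { toFun := fun x => ∑ i, ∑ j, ι i ∘L e i j x ∘L ρ j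
      map_add' := fun x y => by
        simp only [e, mul_add, add_mul, map_add, add_comp, comp_add, Finset.sum_add_distrib]
      map_smul' := fun c x => by
        simp only [e, mul_smul_comm, smul_mul_assoc, map_smul, smul_comp, comp_smul,
          Finset.smul_sum, RingHom.id_apply] }
    (by
      change ∑ i, ∑ j, ι i ∘L e i j 1 ∘L ρ j = 1
      have h1 : ∀ i j, ι i ∘L e i j 1 ∘L ρ j = if i = j then ι i ∘L ρ i else 0 := by
        intro i j
        simp only [e, mul_one, hV]
        split_ifs with hij
        · rw [κ.compress_self, map_one, hij]; rfl
        · simp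
      simp only [h1, Finset.sum_ite_eq, Finset.mem_univ, if_true, hιρ])
    (fun x y => by
      change ∑ i, ∑ j, ι i ∘L e i j (x * y) ∘L ρ j =
        (∑ i, ∑ j, ι i ∘L e i j x ∘L ρ j) ∘L (∑ i, ∑ j, ι i ∘L e i j y ∘L ρ j)
      have h1 : ∀ i j k l, (ι i ∘L e i j x ∘L ρ j) ∘L (ι k ∘L e k l y ∘L ρ l) =
          if j = k then ι i ∘L (e i j x * e j l y) ∘L ρ l else 0 := by
        intro i j k l
        calc _ = ι i ∘L e i j x ∘L (ρ j ∘L ι k) ∘L e k l y ∘L ρ l := rfl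
          _ = _ := by
            rw [hρι]
            split_ifs with hjk
            · subst hjk; rfl
            · simp
      have h2 : ∀ i l, ι i ∘L e i l (x * y) ∘L ρ l =
          ∑ k, ι i ∘L (e i k x * e k l y) ∘L ρ l := by
        intro i l
        rw [← hmul, finsetSum_comp, comp_finsetSum]
      simp only [finsetSum_comp, comp_finsetSum, h1, h2, Finset.sum_ite_eq', Finset.mem_univ,
        if_true]
      rw [Finset.sum_comm]
      conv_rhs => rw [Finset.sum_comm]
      exact Finset.sum_congr rfl fun l _ => Finset.sum_comm)
  have hΦ : ∀ x, Φ x = ∑ i, ∑ j, ι i ∘L e i j x ∘L ρ j := fun x => rfl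
  obtain ⟨B, hB0, hB⟩ := (similar_starAlgHom_iff Φ).1 (hM G Φ
    (by
      let _ := N.weakStar
      let _ := M.weakStar
      change @Continuous _ _ _ (weakStarTopology G) fun x => ∑ i, ∑ j, ι i ∘L e i j x ∘L ρ j
      refine continuous_weakStar_sum _ fun i _ => continuous_weakStar_sum _ fun j _ => ?_
      refine continuous_weakStar_comp_comp (ι i) (ρ j) ?_
      exact @Continuous.comp _ _ _ _ _ (weakStarTopology K) _ _ hφ
        (κ.continuous_compress.comp (continuous_mul_mul _ _)))
    (by
      obtain ⟨D, hD, hD'⟩ := κ.norm_compress_le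
      refine ⟨∑ i, ∑ j, ‖ι i‖ * ‖ρ j‖ * (|C| * (D * (‖(V i : H →L[ℂ] H)‖ * ‖(V j : H →L[ℂ] H)‖))),
        fun x => ?_⟩
      rw [hΦ, Finset.sum_mul]
      refine norm_sum_le_of_le _ fun i _ => ?_
      rw [Finset.sum_mul]
      refine norm_sum_le_of_le _ fun j _ => ?_
      refine (norm_comp_comp_le _ _ _).trans ?_
      rw [mul_assoc (‖ι i‖ * ‖ρ j‖)]
      gcongr
      refine (hC _).trans ?_
      rw [mul_assoc |C|]
      refine mul_le_mul (le_abs_self C) ?_ (norm_nonneg _) (abs_nonneg C)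
      refine (hD' _).trans ?_
      rw [mul_assoc D]
      gcongr
      change ‖star (V i : H →L[ℂ] H) * (x : H →L[ℂ] H) * (V j : H →L[ℂ] H)‖ ≤ _
      calc _ ≤ ‖star (V i : H →L[ℂ] H)‖ * ‖(x : H →L[ℂ] H)‖ * ‖(V j : H →L[ℂ] H)‖ :=
            (norm_mul_le _ _).trans (by gcongr; exact norm_mul_le _ _)
        _ = _ := by rw [norm_star]; ring))
  let o : Fin n := ⟨0, hn⟩
  have hρo : ρ o ∘L ι o = 1 := by rw [hρι, if_pos rfl]
  have hadjι : adjoint (ι o) = ρ o := by rw [← hadj, adjoint_adjoint]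
  -- On the copy `V o y V o*` of the corner, the amplification is `φ y` in the single entry `(o,
  -- o)`.
  have hcorner : ∀ y, Φ (V o * κ.incl y * star (V o)) = ι o ∘L φ y ∘L ρ o := by
    intro y
    rw [hΦ]
    have h1 : ∀ i j, e i j (V o * κ.incl y * star (V o)) =
        if i = o then if j = o then φ y else 0 else 0 := by
      intro i j
      have h2 : star (V i) * (V o * κ.incl y * star (V o)) * V j =
          (star (V i) * V o) * κ.incl y * (star (V o) * V j) := by simp only [mul_assoc]
      simp only [e]
      rw [h2, hV, hV]
      by_cases hi : i = o
      · by_cases hj : j = o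
        · rw [if_pos hi, if_pos hj.symm, if_pos hi, if_pos hj, ← κ.incl_compress, κ.compress_incl,
            κ.compress_incl]
        · rw [if_neg (Ne.symm hj), if_neg hj]; simp
      · rw [if_neg hi, if_neg hi]; simp
    rw [Finset.sum_eq_single o, Finset.sum_eq_single o, h1, if_pos rfl, if_pos rfl]
    · intro j _ hj
      rw [h1, if_pos rfl, if_neg hj]; simp
    · simp
    · intro i _ hi
      refine Finset.sum_eq_zero fun j _ => ?_
      rw [h1, if_neg hi]; simp
    · simp
  have hstar : ∀ T : K →L[ℂ] K, star (ι o ∘L T ∘L ρ o) = ι o ∘L star T ∘L ρ o := by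
    intro T
    rw [star_eq_adjoint, adjoint_comp, adjoint_comp, hadjι, hadj]
    rfl
  have hint : ∀ y, (ι o ∘L φ (star y) ∘L ρ o) ∘L (B : G →L[ℂ] G) =
      (B : G →L[ℂ] G) ∘L (ι o ∘L star (φ y) ∘L ρ o) := by
    intro y
    have h := hB (V o * κ.incl y * star (V o))
    have h1 : star (V o * κ.incl y * star (V o)) = V o * κ.incl (star y) * star (V o) := by
      rw [κ.incl_star]; simp [mul_assoc]
    rw [h1, hcorner, hcorner, hstar] at h
    exact h
  -- At `y = 1` the intertwining relation says that `B` commutes with the projection onto coordinate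
  -- `o`; hence the compression of `B⁻¹` inverts the compression of `B`.
  have hcomm : (ι o ∘L ρ o) ∘L (B : G →L[ℂ] G) = (B : G →L[ℂ] G) ∘L (ι o ∘L ρ o) := by
    have := hint 1
    rw [star_one, map_one, star_one] at this
    exact this
  have hcommi : (↑B⁻¹ : G →L[ℂ] G) ∘L (ι o ∘L ρ o) = (ι o ∘L ρ o) ∘L (↑B⁻¹ : G →L[ℂ] G) := by
    have h : Commute (ι o ∘L ρ o : G →L[ℂ] G) (B : G →L[ℂ] G) := hcomm
    exact h.units_inv_right.symm
  have hcancel : ∀ T : G →L[ℂ] K, ρ o ∘L (ι o ∘L T) = T := fun T => by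
    rw [← comp_assoc, hρo]; rfl
  let A : K →L[ℂ] K := ρ o ∘L (B : G →L[ℂ] G) ∘L ι o
  let A' : K →L[ℂ] K := ρ o ∘L (↑B⁻¹ : G →L[ℂ] G) ∘L ι o
  have hAA' : A * A' = 1 := by
    calc A * A' = ρ o ∘L ((B : G →L[ℂ] G) ∘L (ι o ∘L ρ o)) ∘L (↑B⁻¹ : G →L[ℂ] G) ∘L ι o := rfl
      _ = (ρ o ∘L ι o) ∘L ρ o ∘L ((B : G →L[ℂ] G) * (↑B⁻¹ : G →L[ℂ] G)) ∘L ι o := by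
          rw [← hcomm]; rfl
      _ = ρ o ∘L ι o := by rw [hρo, Units.mul_inv]; rfl
      _ = 1 := hρo
  have hA'A : A' * A = 1 := by
    calc A' * A = ρ o ∘L ((↑B⁻¹ : G →L[ℂ] G) ∘L (ι o ∘L ρ o)) ∘L (B : G →L[ℂ] G) ∘L ι o := rfl
      _ = (ρ o ∘L ι o) ∘L ρ o ∘L ((↑B⁻¹ : G →L[ℂ] G) * (B : G →L[ℂ] G)) ∘L ι o := by
          rw [hcommi]; rfl
      _ = ρ o ∘L ι o := by rw [hρo, Units.inv_mul]; rfl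
      _ = 1 := hρo
  refine ⟨⟨A, A', hAA', hA'A⟩, ?_, fun y => ?_⟩
  · change 0 ≤ A
    rw [nonneg_iff_isPositive] at hB0 ⊢
    have := hB0.conj_adjoint (ρ o)
    rwa [hadj] at this
  · change φ (star y) * A = A * star (φ y)
    calc φ (star y) * A = 1 ∘L φ (star y) ∘L A := rfl
      _ = ρ o ∘L ((ι o ∘L φ (star y) ∘L ρ o) ∘L (B : G →L[ℂ] G)) ∘L ι o := by
          rw [← hρo]; rfl
      _ = A ∘L star (φ y) ∘L (ρ o ∘L ι o) := by rw [hint]; rfl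
      _ = A * star (φ y) := by rw [hρo]; rfl

end VonNeumannAlgebra

end

theorem corollary3p9 {H : Type u} [NormedAddCommGroup H] [InnerProductSpace ℂ H] [CompleteSpace H]
    (M : VonNeumannAlgebra H) (hM : M.IsTypeII₁Factor)
    (τ : M.toStarSubalgebra →ₗ[ℂ] ℂ) (hτ : M.IsNormalTracialState τ)
    (n : ℕ) (hn : 1 ≤ n) (P : M.toStarSubalgebra) (hP : IsStarProjection P)
    (hPn : τ P = 1 / (n : ℂ)) :
    VonNeumannAlgebra.WSP.{u, v} M ↔ VonNeumannAlgebra.WSP.{u, v} (M.corner P hP) := by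
  obtain ⟨V, hV, hsum⟩ := hτ.exists_matrixUnits hM.center_trivial hn hP hPn
  exact ⟨VonNeumannAlgebra.WSP.corner (M.cornerMaps P hP) hP hn V hV hsum,
    VonNeumannAlgebra.WSP.of_corner (M.cornerMaps P hP) hP V hV hsum⟩
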